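/- Consider $N=n+1\ge 2$ parties, Alice and Bob$_1,\dots,$Bob$_{N-1}$, with finite-dimensional Hilbert spaces. In a conference key agreement (CKA) protocol each party has finitely many measurement settings with finitely many outcomes, given by local POVMs $\{G^a_x\},\{G^{b_1}_{y_1}\},\dots,\{G^{b_{N-1}}_{y_{N-1}}\}$, where $x,y_1,\dots,y_{N-1}$ label the settings (used in test and key generation rounds) and $a,b_1,\dots,b_{N-1}$ the outcomes; one setting of each party is used in the key generation rounds, and $X, Y_1,\dots,Y_{N-1}$ denote the registers of the outcomes obtained with these settings. In each round one copy of a state $\rho=\rho_{AB_1\dots B_{N-1}}$ is measured, with statistics $$P_\rho(a,b_1,\dots,b_{N-1}\,|\,x,y_1,\dots,y_{N-1})=\mathrm{Tr}\big[(G^a_x\otimes G^{b_1}_{y_1}\otimes\dots\otimes G^{b_{N-1}}_{y_{N-1}})\,\rho\big].$$ The asymptotic key rate of the protocol on $\rho$ is $$r_\infty=\max\Big[0,\ \inf_{\psi} H(X|E)_{\psi}-\max_i H(X|Y_i)\Big],$$ where $H(X|E)=H(XE)-H(E)$ and $H(X|Y_i)=H(XY_i)-H(Y_i)$ are conditional von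 Neumann entropies (base-2 logarithm), and the infimum is over all pure states $\psi$ of the parties and an eavesdropper's finite-dimensional system $E$ whose reduced state $\sigma$ on the parties has the observed statistics, $P_\sigma=P_\rho$. For a bipartition $S_\alpha|\bar S_\alpha$ of the parties into two nonempty subsets, a state is separable across it if it is of the form $\sum_j q_j\,\rho^j_{S_\alpha}\otimes\rho^j_{\bar S_\alpha}$ with states $\rho^j_{S_\alpha}$, $\rho^j_{\bar S_\alpha}$ and a (finite) probability distribution $(q_j)$. **Theorem 2.** If $r_\infty>0$, then the statistics prove entanglement of the parties' state across every bipartition: for every bipartition $S_\alpha|\bar S_\alpha$, no state that is separable across it has the statistics $P_\rho$. Moreover, for every bipartition there are real coefficients $c^{(\alpha)}$ such that $$W_\alpha=\sum_{\substack{a,b_1,\dots,b_{N-1}\\ x,y_1,\dots,y_{N-1}}} c^{(\alpha)}_{\substack{a,b_1,\dots,b_{N-1}\\ x,y_1,\dots,y_{N-1}}}\ G^a_x\otimes G^{b_1}_{y_1}\otimes\dots\otimes G^{b_{N-1}}_{y_{N-1}}$$ is an entanglement witness for $S_\alpha|\bar S_\alpha$ (Hermitian, $\mathrm{Tr}(W_\alpha\sigma)\ge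 0$ for all states $\sigma$ separable across $S_\alpha|\bar S_\alpha$, negative expectation on some state that is not) with $\mathrm{Tr}(W_\alpha\rho)<0$. -/

import Mathlib

open scoped BigOperators Kronecker ComplexOrder

namespace CKA

noncomputable section

/-! ### States, tensor products, separability

All Hilbert spaces are finite dimensional and written in orthonormal bases: the space with basis
`κ` has the matrices `Matrix κ κ ℂ` as operators, and the joint space of parties `i : ι` with local
bases `H i` has the basis `∀ i, H i`. -/

/-- A quantum state (density matrix). -/
def IsState {κ : Type*} [Fintype κ] (ρ : Matrix κ κ ℂ) : Prop :=
  ρ.PosSemidef ∧ ρ.trace = 1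

section Parties

variable {ι : Type*} [Fintype ι] [DecidableEq ι] {H : ι → Type*}

/-- The tensor product `⨂ i, A i` of one local operator for each party. -/
def tensor (A : ∀ i, Matrix (H i) (H i) ℂ) : Matrix (∀ i, H i) (∀ i, H i) ℂ :=
  Matrix.of fun f g => ∏ i, A i (f i) (g i)

/-- The tensor product of an operator of the parties in `S` and one of the parties outside `S`. -/
def bipartiteTensor (S : Finset ι)
    (A : Matrix (∀ i : {i // i ∈ S}, H i) (∀ i : {i // i ∈ S}, H i) ℂ)
    (B : Matrix (∀ i : {i // i ∉ S}, H i) (∀ i : {i // i ∉ S}, H i) ℂ) :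
    Matrix (∀ i, H i) (∀ i, H i) ℂ :=
  Matrix.of fun f g =>
    A (fun i => f i) (fun i => g i) * B (fun i => f i) (fun i => g i)

variable [∀ i, Fintype (H i)]

/-- `ρ` is separable with respect to the partition `S | Sᶜ`. -/
def IsSeparable (S : Finset ι) (ρ : Matrix (∀ i, H i) (∀ i, H i) ℂ) : Prop :=
  ∃ (m : ℕ) (q : Fin m → ℝ)
    (A : Fin m → Matrix (∀ i : {i // i ∈ S}, H i) (∀ i : {i // i ∈ S}, H i) ℂ)
    (B : Fin m → Matrix (∀ i : {i // i ∉ S}, H i) (∀ i : {i // i ∉ S}, H i) ℂ),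
    (∀ j, 0 ≤ q j) ∧ ∑ j, q j = 1 ∧ (∀ j, IsState (A j)) ∧ (∀ j, IsState (B j)) ∧
      ρ = ∑ j, (q j : ℂ) • bipartiteTensor S (A j) (B j)

/-- `W` is an entanglement witness for the partition `S | Sᶜ`: it is Hermitian, nonnegative on the
states that are separable across the partition, and negative on at least one entangled state. -/
def IsEntanglementWitness (S : Finset ι) (W : Matrix (∀ i, H i) (∀ i, H i) ℂ) : Prop :=
  W.IsHermitian ∧
    (∀ σ : Matrix (∀ i, H i) (∀ i, H i) ℂ, IsSeparable S σ → 0 ≤ (W * σ).trace.re) ∧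
    ∃ τ : Matrix (∀ i, H i) (∀ i, H i) ℂ,
      IsState τ ∧ ¬ IsSeparable S τ ∧ (W * τ).trace.re < 0

end Parties

/-! ### Entropies, in bits -/

/-- Von Neumann entropy `-Tr[ρ log₂ ρ]` of a positive semidefinite matrix
(with `0 log₂ 0 = 0`, which is what `Real.logb 2 0 = 0` gives). -/
def vonNeumannEntropy {κ : Type*} [Fintype κ] [DecidableEq κ] (ρ : Matrix κ κ ℂ) : ℝ :=
  -(ρ * cfc (Real.logb 2) ρ).trace.re

/-- The entropy of a classical register with distribution `p`, i.e. the von Neumann entropy of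
the diagonal matrix with entries `p`. -/
def shannonEntropy {κ : Type*} [Fintype κ] (p : κ → ℝ) : ℝ :=
  -∑ a, p a * Real.logb 2 (p a)

/-! ### Partial traces and pure states of two systems -/

/-- Partial trace over the first system. -/
def traceFst {κ ε : Type*} [Fintype κ] (R : Matrix (κ × ε) (κ × ε) ℂ) : Matrix ε ε ℂ :=
  Matrix.of fun e e' => ∑ f, R (f, e) (f, e')

/-- Partial trace over the second system. -/
def traceSnd {κ ε : Type*} [Fintype ε] (R : Matrix (κ × ε) (κ × ε) ℂ) : Matrix κ κ ℂ :=
  Matrix.of fun f f' => ∑ e, R (f, e) (f', e)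

/-- The operator `|ψ⟩⟨ψ|`. -/
def pureState {κ : Type*} (ψ : κ → ℂ) : Matrix κ κ ℂ :=
  Matrix.vecMulVec ψ (star ψ)

/-! ### Conference key agreement -/

/-- A conference key agreement protocol for `N = n + 1` parties: party `0` is Alice and party
`i.succ` is the `i`-th Bob. Party `i` has the local basis `H i`, the measurement settings `I i` and
the outcomes `O i`. Setting `x : I i` is the POVM `povm i x`, and the setting `key i` is the one
used in the key generation rounds. -/
structure Protocol {n : ℕ} (H I O : Fin (n + 1) → Type*) [∀ i, Fintype (H i)]
    [∀ i, DecidableEq (H i)] [∀ i, Fintype (O i)] where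
  povm : ∀ i, I i → O i → Matrix (H i) (H i) ℂ
  povm_posSemidef : ∀ i x a, (povm i x a).PosSemidef
  povm_sum : ∀ i x, ∑ a, povm i x a = 1
  key : ∀ i, I i

namespace Protocol

variable {n : ℕ} {H I O : Fin (n + 1) → Type*} [∀ i, Fintype (H i)] [∀ i, DecidableEq (H i)]
  [∀ i, Fintype (O i)]

/-- The joint POVM element `G_x^a ⊗ G_{y₁}^{b₁} ⊗ ⋯`, for the settings `x` and outcomes `a` of all
the parties. -/
def effect (P : Protocol H I O) (x : ∀ i, I i) (a : ∀ i, O i) :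
    Matrix (∀ i, H i) (∀ i, H i) ℂ :=
  tensor fun i => P.povm i (x i) (a i)

/-- The probability of the outcomes `a` given the settings `x`, in the state `ρ`. -/
def prob (P : Protocol H I O) (ρ : Matrix (∀ i, H i) (∀ i, H i) ℂ)
    (x : ∀ i, I i) (a : ∀ i, O i) : ℝ :=
  (P.effect x a * ρ).trace.re

/-- The states `ρ` and `σ` lead to the same outcome statistics in the protocol. -/
def SameStatistics (P : Protocol H I O) (ρ σ : Matrix (∀ i, H i) (∀ i, H i) ℂ) : Prop :=
  ∀ x a, P.prob ρ x a = P.prob σ x a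

/-- The operator `∑ c_{x,a} G_x^a ⊗ G_{y₁}^{b₁} ⊗ ⋯` with real coefficients `c`. -/
def witness [∀ i, Fintype (I i)] (P : Protocol H I O) (c : (∀ i, I i) → (∀ i, O i) → ℝ) :
    Matrix (∀ i, H i) (∀ i, H i) ℂ :=
  ∑ x, ∑ a, (c x a : ℂ) • P.effect x a

variable [∀ i, DecidableEq (O i)]

/-- The joint distribution of the key generation outcomes `X` of Alice and `Yᵢ` of the `i`-th
Bob. -/
def keyDist (P : Protocol H I O) (ρ : Matrix (∀ i, H i) (∀ i, H i) ℂ) (i : Fin n)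
    (ab : O 0 × O i.succ) : ℝ :=
  ∑ o : ∀ j, O j, if o 0 = ab.1 ∧ o i.succ = ab.2 then P.prob ρ P.key o else 0

/-- `H(X|Yᵢ) = H(XYᵢ) - H(Yᵢ)`. -/
def condEntropyBob (P : Protocol H I O) (ρ : Matrix (∀ i, H i) (∀ i, H i) ℂ) (i : Fin n) : ℝ :=
  shannonEntropy (P.keyDist ρ i) - shannonEntropy fun b => ∑ a, P.keyDist ρ i (a, b)

/-- The unnormalised state of Eve's system `E` belonging to the key generation outcome `a` of
Alice, when the joint state of all the parties and Eve is `R`. -/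
def eveState (P : Protocol H I O) {ε : Type*} [Fintype ε] [DecidableEq ε]
    (R : Matrix ((∀ i, H i) × ε) ((∀ i, H i) × ε) ℂ) (a : O 0) : Matrix ε ε ℂ :=
  traceFst ((tensor (Function.update (fun i => (1 : Matrix (H i) (H i) ℂ)) 0
    (P.povm 0 (P.key 0) a)) ⊗ₖ (1 : Matrix ε ε ℂ)) * R)

/-- `H(X|E) = H(XE) - H(E)`, when the joint state of all the parties and Eve is `R`. The state of
`XE` is the classical-quantum state with the blocks `eveState`. -/
def condEntropyEve (P : Protocol H I O) {ε : Type*} [Fintype ε] [DecidableEq ε]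
    (R : Matrix ((∀ i, H i) × ε) ((∀ i, H i) × ε) ℂ) : ℝ :=
  vonNeumannEntropy (Matrix.blockDiagonal (P.eveState R)) - vonNeumannEntropy (traceFst R)

/-- The values that `H(X|E)` may have when the observed statistics are those of `ρ`: the joint state
of the parties is only known through these statistics, and Eve holds a purification of it. -/
def eveEntropies (P : Protocol H I O) (ρ : Matrix (∀ i, H i) (∀ i, H i) ℂ) : Set ℝ :=
  {h | ∃ (k : ℕ) (ψ : (∀ i, H i) × Fin k → ℂ),
    IsState (traceSnd (pureState ψ)) ∧ P.SameStatistics ρ (traceSnd (pureState ψ)) ∧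
      h = P.condEntropyEve (pureState ψ)}

/-- The asymptotic conference key rate
`r_∞ = max [0, H(X|E) - max_i H(X|Yᵢ)]`
of the protocol run on the state `ρ`, where, the parties knowing no more than the statistics of
their outcomes, `H(X|E)` is taken in the worst case compatible with these. -/
def keyRate (P : Protocol H I O) (ρ : Matrix (∀ i, H i) (∀ i, H i) ℂ) : ℝ :=
  max 0 (sInf (P.eveEntropies ρ) - ⨆ i : Fin n, P.condEntropyBob ρ i)

end Protocol

end

end CKA

/-! Suppose a state `σ` separable across `S` has the observed statistics. The bipartition is proper,
so some Bob `i` lies on the other side from Alice. Write `σ` as a sum of unnormalised pure product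
states and let Eve hold the purification whose standard basis labels the terms. If Eve measures that
label `K`, then X and Yᵢ are independent given `K`, whence H(X|E) ≤ H(X|K) = H(X|K Yᵢ) ≤ H(X|Yᵢ).
This purification is admissible in the infimum, and H(X|Yᵢ) depends only on the statistics, so the
key rate is zero.

The first inequality is data processing for Eve's measurement (`relEntropy_diag_le`): H(X|E) is
minus a sum of relative entropies Tr[A (log A - log B)] with A ≤ B. These are relative entropies of
classical weights built from eigenvalues and eigenbasis overlaps; a derivative in an auxiliary
parameter t reduces monotonicity to a quadratic inequality (`sum_sq_div_le_resolvent`), proved by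
completing squares. The second inequality is the log-sum inequality (`condEntropy_le_of_markov`).
Nonnegativity of H(X|E) (`condEntropyEve_nonneg`) makes the infimum a genuine lower bound.

For the witness (`exists_witness`), the statistics of separable states form the convex hull of the
compact set of statistics of product states. In finite dimension this hull is compact, and the
statistics of `ρ` lie outside it. A separating affine functional on statistics, its constant
absorbed by normalisation of probabilities, gives the coefficients. -/

namespace CKA

open Filter Topology Matrix

/-! ### Scalar inequalities for relative entropies -/

section LogSum

/-- If `t ↦ ∑ r² / (s + t r)` is dominated by `t ↦ ∑ p² / (q + t p)`, then integrating over `t`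
gives the corresponding inequality between relative entropies. -/
theorem sum_mul_log_div_le_of_resolvent {α κ : Type*} [Fintype α] [Fintype κ]
    {p q : α → ℝ} {r s : κ → ℝ} (hp : ∀ i, 0 ≤ p i) (hq : ∀ i, 0 ≤ q i)
    (hr : ∀ k, 0 ≤ r k) (hs : ∀ k, 0 ≤ s k)
    (hpq : ∀ i, q i = 0 → p i = 0) (hrs : ∀ k, s k = 0 → r k = 0)
    (hsum : ∑ i, p i = ∑ k, r k)
    (h : ∀ t : ℝ, 0 < t → ∑ k, r k ^ 2 / (s k + t * r k) ≤ ∑ i, p i ^ 2 / (q i + t * p i)) :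
    ∑ k, r k * Real.log (r k / s k) ≤ ∑ i, p i * Real.log (p i / q i) := by
  have hderiv : ∀ (a b : ℝ), 0 ≤ a → 0 ≤ b → (b = 0 → a = 0) → ∀ t : ℝ, 0 ≤ t →
      HasDerivAt (fun t => a * Real.log ((b + t * a) / b)) (a ^ 2 / (b + t * a)) t := by
    intro a b ha hb hab t ht
    rcases eq_or_lt_of_le hb with hb0 | hb0
    · have := hab hb0.symm
      subst this
      simpa using hasDerivAt_const t (0 : ℝ)
    · have hpos : 0 < b + t * a := by positivity
      have h1 : HasDerivAt (fun t => (b + t * a) / b) (a / b) t := by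
        have := ((hasDerivAt_id t).mul_const a).const_add b |>.div_const b
        simpa using this
      have h2 := (h1.log (by positivity)).const_mul a
      rwa [div_div_div_cancel_right₀ hb0.ne', mul_div_assoc', ← sq] at h2
  -- `F` vanishes at 0, has the assumed nonnegative difference as derivative, and tends at infinity
  -- to the difference of the two relative entropies.
  set F : ℝ → ℝ := fun t => ∑ i, p i * Real.log ((q i + t * p i) / q i) -
    ∑ k, r k * Real.log ((s k + t * r k) / s k) with hF
  have hFd : ∀ t : ℝ, 0 ≤ t → HasDerivAt F
      (∑ i, p i ^ 2 / (q i + t * p i) - ∑ k, r k ^ 2 / (s k + t * r k)) t := fun t ht =>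
    (HasDerivAt.fun_sum fun i _ => hderiv _ _ (hp i) (hq i) (hpq i) t ht).sub
      (HasDerivAt.fun_sum fun k _ => hderiv _ _ (hr k) (hs k) (hrs k) t ht)
  have hmono : MonotoneOn F (Set.Ici 0) := by
    refine monotoneOn_of_deriv_nonneg (convex_Ici 0)
      (fun t ht => (hFd t ht).continuousAt.continuousWithinAt) ?_ ?_
    · intro t ht
      rw [interior_Ici] at ht
      exact (hFd t (le_of_lt ht)).differentiableAt.differentiableWithinAt
    · intro t ht
      rw [interior_Ici] at ht
      rw [(hFd t (le_of_lt ht)).deriv]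
      exact sub_nonneg.2 (h t ht)
  have hF0 : F 0 = 0 := by
    have h1 : ∀ (a b : ℝ), a * Real.log ((b + 0 * a) / b) = 0 := by
      intro a b
      by_cases hb : b = 0 <;> simp [hb]
    simp only [hF, h1, Finset.sum_const_zero, sub_zero]
  have hlim : ∀ (a b : ℝ), 0 ≤ a → 0 ≤ b → (b = 0 → a = 0) →
      Tendsto (fun t : ℝ => a * Real.log ((b + t * a) / b) - a * Real.log t) atTop
        (𝓝 (a * Real.log (a / b))) := by
    intro a b ha hb hab
    rcases eq_or_lt_of_le ha with ha0 | ha0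
    · simp [← ha0]
    have hb0 : b ≠ 0 := fun h => ha0.ne' (hab h)
    have h1 : Tendsto (fun t : ℝ => (b / t + a) / b) atTop (𝓝 ((0 + a) / b)) :=
      ((tendsto_const_nhds.div_atTop tendsto_id).add_const a).div_const b
    rw [zero_add] at h1
    have h2 := (h1.log (by positivity)).const_mul a
    refine h2.congr' ?_
    filter_upwards [eventually_gt_atTop 0] with t ht
    have hb' : 0 < b := lt_of_le_of_ne hb hb0.symm
    rw [← mul_sub, ← Real.log_div (by positivity) ht.ne']
    congr 2
    field_simp
  have hlimF : Tendsto F atTop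
      (𝓝 (∑ i, p i * Real.log (p i / q i) - ∑ k, r k * Real.log (r k / s k))) := by
    have h1 := (tendsto_finsetSum Finset.univ fun i _ =>
      hlim _ _ (hp i) (hq i) (hpq i)).sub (tendsto_finsetSum Finset.univ fun k _ =>
      hlim _ _ (hr k) (hs k) (hrs k))
    refine h1.congr fun t => ?_
    -- The divergent `log t` terms carry the total masses, which agree, so they cancel.
    simp only [hF, Finset.sum_sub_distrib, ← Finset.sum_mul, hsum]
    ring
  have : 0 ≤ ∑ i, p i * Real.log (p i / q i) - ∑ k, r k * Real.log (r k / s k) := by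
    refine ge_of_tendsto hlimF ?_
    filter_upwards [eventually_ge_atTop 0] with t ht
    have := hmono (Set.mem_Ici.2 le_rfl) (Set.mem_Ici.2 ht) ht
    rwa [hF0] at this
  linarith

/-- The log-sum inequality. -/
theorem sum_mul_logb_div_le {κ : Type*} [Fintype κ] {p q : κ → ℝ} (hp : ∀ k, 0 ≤ p k)
    (hq : ∀ k, 0 ≤ q k) (hpq : ∀ k, q k = 0 → p k = 0) :
    (∑ k, p k) * Real.logb 2 ((∑ k, p k) / ∑ k, q k) ≤
      ∑ k, p k * Real.logb 2 (p k / q k) := by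
  set P := ∑ k, p k
  set Q := ∑ k, q k
  have hP : 0 ≤ P := Finset.sum_nonneg fun k _ => hp k
  rcases eq_or_lt_of_le hP with hP0 | hP0
  · have h0 : ∀ k, p k = 0 := fun k =>
      (Finset.sum_eq_zero_iff_of_nonneg fun k _ => hp k).1 hP0.symm k (Finset.mem_univ k)
    simp [← hP0, h0]
  have hQ0 : 0 < Q := by
    refine lt_of_le_of_ne (Finset.sum_nonneg fun k _ => hq k) fun h => hP0.ne' ?_
    exact Finset.sum_eq_zero fun k _ => hpq k
      ((Finset.sum_eq_zero_iff_of_nonneg fun k _ => hq k).1 h.symm k (Finset.mem_univ k))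
  -- This is `1 - 1/x ≤ log x` at `x = (p k / q k) / (P / Q)`; the correction terms sum to zero over
  -- `k`.
  have key : ∀ k, p k * Real.log (P / Q) + (p k - q k * (P / Q)) ≤ p k * Real.log (p k / q k) := by
    intro k
    rcases eq_or_lt_of_le (hp k) with h0 | h0
    · simp only [← h0, zero_mul, zero_sub, zero_add]
      have := hq k
      have : 0 ≤ q k * (P / Q) := by positivity
      linarith
    · have hqk : 0 < q k := lt_of_le_of_ne (hq k) fun h => h0.ne' (hpq k h.symm)
      have h1 := Real.one_sub_inv_le_log_of_pos (x := (p k / q k) / (P / Q)) (by positivity)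
      rw [Real.log_div (by positivity) (by positivity)] at h1
      have h2 := mul_le_mul_of_nonneg_left h1 h0.le
      have h3 : p k * (1 - (p k / q k / (P / Q))⁻¹) = p k - q k * (P / Q) := by
        field_simp
      rw [h3] at h2
      linarith
  have hs := Finset.sum_le_sum fun k (_ : k ∈ Finset.univ) => key k
  rw [Finset.sum_add_distrib, Finset.sum_sub_distrib, ← Finset.sum_mul, ← Finset.sum_mul] at hs
  have h4 : Q * (P / Q) = P := by field_simp
  change P * Real.log (P / Q) + (P - Q * (P / Q)) ≤ _ at hs
  rw [h4, sub_self, add_zero] at hs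
  simp only [Real.logb, ← mul_div_assoc, ← Finset.sum_div]
  exact div_le_div_of_nonneg_right hs (Real.log_nonneg (by norm_num))

end LogSum

/-! ### Traces of functions of two noncommuting matrices -/

section Spectral

variable {κ : Type*} [Fintype κ] [DecidableEq κ]

/-- The squared overlaps of two eigenbases. -/
noncomputable def overlap {A B : Matrix κ κ ℂ} (hA : A.IsHermitian) (hB : B.IsHermitian)
    (i j : κ) : ℝ :=
  ‖((hA.eigenvectorUnitary : Matrix κ κ ℂ)ᴴ * (hB.eigenvectorUnitary : Matrix κ κ ℂ)) i j‖ ^ 2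

theorem overlap_nonneg {A B : Matrix κ κ ℂ} (hA : A.IsHermitian) (hB : B.IsHermitian) (i j : κ) :
    0 ≤ overlap hA hB i j := by
  unfold overlap; positivity

theorem cfc_eq_conj {A : Matrix κ κ ℂ} (hA : A.IsHermitian) (f : ℝ → ℝ) :
    cfc f A = (hA.eigenvectorUnitary : Matrix κ κ ℂ) *
      diagonal (fun i => (f (hA.eigenvalues i) : ℂ)) *
        (hA.eigenvectorUnitary : Matrix κ κ ℂ)ᴴ := by
  rw [hA.cfc_eq, IsHermitian.cfc, Unitary.conjStarAlgAut_apply]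
  rfl

theorem trace_cfc_mul_cfc {A B : Matrix κ κ ℂ} (hA : A.IsHermitian) (hB : B.IsHermitian)
    (f g : ℝ → ℝ) :
    (cfc f A * cfc g B).trace.re =
      ∑ i, ∑ j, f (hA.eigenvalues i) * g (hB.eigenvalues j) * overlap hA hB i j := by
  rw [cfc_eq_conj hA, cfc_eq_conj hB]
  unfold overlap
  set U : Matrix κ κ ℂ := hA.eigenvectorUnitary.1
  set V : Matrix κ κ ℂ := hB.eigenvectorUnitary.1
  set D := diagonal (fun i => (f (hA.eigenvalues i) : ℂ))
  set D' := diagonal (fun i => (g (hB.eigenvalues i) : ℂ))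
  have h1 : (U * D * Uᴴ * (V * D' * Vᴴ)).trace = (D * (Uᴴ * V) * (D' * (Uᴴ * V)ᴴ)).trace := by
    rw [conjTranspose_mul, conjTranspose_conjTranspose]
    simp only [Matrix.mul_assoc]
    rw [Matrix.trace_mul_comm U]
    simp only [Matrix.mul_assoc]
  rw [h1, Matrix.trace, Complex.re_sum]
  refine Finset.sum_congr rfl fun i _ => ?_
  rw [Matrix.diag_apply, Matrix.mul_apply, Complex.re_sum]
  refine Finset.sum_congr rfl fun j _ => ?_
  rw [diagonal_mul, diagonal_mul, conjTranspose_apply]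
  have : (f (hA.eigenvalues i) : ℂ) * (Uᴴ * V) i j *
      ((g (hB.eigenvalues j) : ℂ) * star ((Uᴴ * V) i j)) =
      ((f (hA.eigenvalues i) * g (hB.eigenvalues j) * ‖(Uᴴ * V) i j‖ ^ 2 : ℝ) : ℂ) := by
    have h2 := Complex.mul_conj ((Uᴴ * V) i j)
    rw [Complex.normSq_eq_norm_sq] at h2
    rw [show (f (hA.eigenvalues i) : ℂ) * (Uᴴ * V) i j *
      ((g (hB.eigenvalues j) : ℂ) * star ((Uᴴ * V) i j)) = (f (hA.eigenvalues i) : ℂ) *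
      (g (hB.eigenvalues j) : ℂ) * ((Uᴴ * V) i j * star ((Uᴴ * V) i j)) by ring]
    change _ * ((Uᴴ * V) i j * (starRingEnd ℂ) ((Uᴴ * V) i j)) = _
    rw [h2]
    push_cast
    ring
  rw [this, Complex.ofReal_re]

theorem sum_overlap_left {A B : Matrix κ κ ℂ} (hA : A.IsHermitian) (hB : B.IsHermitian) (i : κ) :
    ∑ j, overlap hA hB i j = 1 := by
  unfold overlap
  let U : unitaryGroup κ ℂ := hA.eigenvectorUnitary
  let V : unitaryGroup κ ℂ := hB.eigenvectorUnitary
  have h1 : ((star U * V : unitaryGroup κ ℂ) : Matrix κ κ ℂ) *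
      ((star U * V : unitaryGroup κ ℂ) : Matrix κ κ ℂ)ᴴ = 1 :=
    Unitary.coe_mul_star_self (star U * V)
  have h2 := congrFun (congrFun h1 i) i
  rw [Matrix.mul_apply, one_apply_eq] at h2
  change ∑ j, ‖((U : Matrix κ κ ℂ)ᴴ * (V : Matrix κ κ ℂ)) i j‖ ^ 2 = 1
  have h3 : ∑ j, ((‖((U : Matrix κ κ ℂ)ᴴ * (V : Matrix κ κ ℂ)) i j‖ ^ 2 : ℝ) : ℂ) = 1 := by
    rw [← h2]
    refine Finset.sum_congr rfl fun j _ => ?_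
    rw [conjTranspose_apply, ← Complex.normSq_eq_norm_sq, ← Complex.mul_conj]
    rfl
  exact_mod_cast h3

/-- The relative entropy `Tr[A (log A - log B)]` in terms of eigenvalues and overlaps. -/
theorem trace_mul_log_sub_log {A B : Matrix κ κ ℂ} (hA : A.IsHermitian) (hB : B.IsHermitian) :
    (A * cfc (Real.logb 2) A).trace.re - (A * cfc (Real.logb 2) B).trace.re =
      ∑ i, ∑ j, overlap hA hB i j * (hA.eigenvalues i *
        (Real.logb 2 (hA.eigenvalues i) - Real.logb 2 (hB.eigenvalues j))) := by
  have hcont : ∀ f : ℝ → ℝ, ContinuousOn f (spectrum ℝ A) := fun f =>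
    (Matrix.finite_real_spectrum (A := A)).continuousOn f
  have h1 : A * cfc (Real.logb 2) A = cfc (fun x => x * Real.logb 2 x) A := by
    rw [cfc_mul (fun x => x) _ A (hcont _) (hcont _), cfc_id' ℝ A hA.isSelfAdjoint]
  have h2 : (A * cfc (Real.logb 2) A).trace.re =
      ∑ i, ∑ j, hA.eigenvalues i * Real.logb 2 (hA.eigenvalues i) * overlap hA hB i j := by
    have h3 := trace_cfc_mul_cfc hA hB (fun x => x * Real.logb 2 x) (fun _ => 1)
    rw [cfc_const_one ℝ B hB.isSelfAdjoint, Matrix.mul_one, ← h1] at h3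
    simpa using h3
  have h4 : (A * cfc (Real.logb 2) B).trace.re =
      ∑ i, ∑ j, hA.eigenvalues i * Real.logb 2 (hB.eigenvalues j) * overlap hA hB i j := by
    have h3 := trace_cfc_mul_cfc hA hB (fun x => x) (Real.logb 2)
    rwa [cfc_id' ℝ A hA.isSelfAdjoint] at h3
  rw [h2, h4, ← Finset.sum_sub_distrib]
  refine Finset.sum_congr rfl fun i _ => ?_
  rw [← Finset.sum_sub_distrib]
  refine Finset.sum_congr rfl fun j _ => ?_
  ring

/-- The unitary that changes between two eigenbases. -/
noncomputable def eigenbasisChange {A B : Matrix κ κ ℂ} (hA : A.IsHermitian)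
    (hB : B.IsHermitian) : Matrix κ κ ℂ :=
  (hA.eigenvectorUnitary : Matrix κ κ ℂ)ᴴ * (hB.eigenvectorUnitary : Matrix κ κ ℂ)

theorem ofReal_overlap {A B : Matrix κ κ ℂ} (hA : A.IsHermitian) (hB : B.IsHermitian) (i j : κ) :
    (overlap hA hB i j : ℂ) = star (eigenbasisChange hA hB i j) * eigenbasisChange hA hB i j := by
  unfold overlap eigenbasisChange
  rw [← Complex.normSq_eq_norm_sq]
  exact Complex.normSq_eq_conj_mul_self

/-- The operator `B - A` written in the eigenbasis of `B`. -/
theorem posSemidef_diagonal_sub {A B : Matrix κ κ ℂ} (hA : A.IsHermitian)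
    (hB : B.IsHermitian) (hAB : (B - A).PosSemidef) :
    (diagonal (fun i => (hB.eigenvalues i : ℂ)) - (eigenbasisChange hA hB)ᴴ *
      (diagonal (fun i => (hA.eigenvalues i : ℂ)) * eigenbasisChange hA hB)).PosSemidef := by
  unfold eigenbasisChange
  have hA' := cfc_eq_conj hA (fun x => x)
  have hB' := cfc_eq_conj hB (fun x => x)
  rw [cfc_id' ℝ A hA.isSelfAdjoint] at hA'
  rw [cfc_id' ℝ B hB.isSelfAdjoint] at hB'
  have hV : (hB.eigenvectorUnitary : Matrix κ κ ℂ)ᴴ * hB.eigenvectorUnitary = 1 :=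
    Unitary.coe_star_mul_self hB.eigenvectorUnitary
  set U : Matrix κ κ ℂ := hA.eigenvectorUnitary.1
  set V : Matrix κ κ ℂ := hB.eigenvectorUnitary.1
  have h1 := hAB.conjTranspose_mul_mul_same V
  have h2 : Vᴴ * B * V = diagonal (fun i => (hB.eigenvalues i : ℂ)) := by
    conv_lhs => rw [hB']
    calc Vᴴ * (V * diagonal (fun i => (hB.eigenvalues i : ℂ)) * Vᴴ) * V
        = (Vᴴ * V) * diagonal (fun i => (hB.eigenvalues i : ℂ)) * (Vᴴ * V) := by
          simp only [Matrix.mul_assoc]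
      _ = _ := by rw [hV, Matrix.one_mul, Matrix.mul_one]
  have h3 : Vᴴ * A * V = (Uᴴ * V)ᴴ * (diagonal (fun i => (hA.eigenvalues i : ℂ)) * (Uᴴ * V)) := by
    conv_lhs => rw [hA']
    rw [conjTranspose_mul, conjTranspose_conjTranspose]
    simp only [Matrix.mul_assoc]
  rwa [Matrix.mul_sub, Matrix.sub_mul, h2, h3] at h1

/-- If `A ≤ B`, the diagonal of `A` in an eigenbasis of `B` is bounded by the eigenvalues. -/
theorem sum_eigenvalues_mul_overlap_le {A B : Matrix κ κ ℂ} (hA : A.IsHermitian)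
    (hB : B.IsHermitian) (hAB : (B - A).PosSemidef) (j : κ) :
    ∑ i, hA.eigenvalues i * overlap hA hB i j ≤ hB.eigenvalues j := by
  have h1 := (posSemidef_diagonal_sub hA hB hAB).diag_nonneg (i := j)
  rw [Matrix.sub_apply, diagonal_apply_eq, Matrix.mul_apply] at h1
  have h4 : ∑ i, (eigenbasisChange hA hB)ᴴ j i *
      (diagonal (fun i => (hA.eigenvalues i : ℂ)) * eigenbasisChange hA hB) i j =
      ((∑ i, hA.eigenvalues i * overlap hA hB i j : ℝ) : ℂ) := by
    rw [Complex.ofReal_sum]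
    refine Finset.sum_congr rfl fun i _ => ?_
    rw [diagonal_mul, conjTranspose_apply, Complex.ofReal_mul, ofReal_overlap]
    ring
  rw [h4, ← Complex.ofReal_sub, Complex.zero_le_real] at h1
  linarith

/-- The kernel of `B` lies in that of `A`. Hence the default values of the logarithm and of division
at a zero eigenvalue of `B` never carry weight. -/
theorem overlap_mul_eigenvalue_eq_zero {A B : Matrix κ κ ℂ} (hA : A.PosSemidef)
    (hB : B.IsHermitian) (hAB : (B - A).PosSemidef) {i j : κ} (hj : hB.eigenvalues j = 0) :
    hA.1.eigenvalues i * overlap hA.1 hB i j = 0 := by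
  have h1 := sum_eigenvalues_mul_overlap_le hA.1 hB hAB j
  rw [hj] at h1
  have h2 : ∀ i ∈ Finset.univ, 0 ≤ hA.1.eigenvalues i * overlap hA.1 hB i j := fun i _ =>
    mul_nonneg (hA.eigenvalues_nonneg i) (overlap_nonneg _ _ _ _)
  exact (Finset.sum_eq_zero_iff_of_nonneg h2).1 (le_antisymm h1 (Finset.sum_nonneg h2)) i
    (Finset.mem_univ i)

end Spectral

/-! ### Monotonicity of relative entropy, and entropies of classical-quantum states -/

section Pinching

variable {κ : Type*}

theorem re_diag_nonneg {A : Matrix κ κ ℂ} (hA : A.PosSemidef) (k : κ) :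
    0 ≤ (A k k).re :=
  (Complex.nonneg_iff.1 (hA.diag_nonneg (i := k))).1

theorem ofReal_re_diag {A : Matrix κ κ ℂ} (hA : A.PosSemidef) (k : κ) :
    ((A k k).re : ℂ) = A k k :=
  (Complex.eq_re_of_ofReal_le (r := 0) (by simpa using hA.diag_nonneg (i := k))).symm

theorem posSemidef_sum_sub {o : Type*} [Fintype o] {A : o → Matrix κ κ ℂ}
    (hA : ∀ a, (A a).PosSemidef) (a : o) : (∑ b, A b - A a).PosSemidef := by
  classical
  rw [← Finset.add_sum_erase _ _ (Finset.mem_univ a), add_sub_cancel_left]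
  exact posSemidef_sum _ fun b _ => hA b

variable [Fintype κ] [DecidableEq κ]

/-- `Tr[A Z]` for diagonal `Z`, computed in the eigenbasis of `A`. -/
theorem sum_eigenvalues_mul_conj_diagonal {A : Matrix κ κ ℂ} (hA : A.IsHermitian) (z : κ → ℂ) :
    ∑ i, (hA.eigenvalues i : ℂ) * ((hA.eigenvectorUnitary : Matrix κ κ ℂ)ᴴ * diagonal z *
      (hA.eigenvectorUnitary : Matrix κ κ ℂ)) i i = ∑ k, A k k * z k := by
  have hA' := cfc_eq_conj hA (fun x => x)
  rw [cfc_id' ℝ A hA.isSelfAdjoint] at hA'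
  set U : Matrix κ κ ℂ := hA.eigenvectorUnitary.1
  have h1 : ∑ i, (hA.eigenvalues i : ℂ) * (Uᴴ * diagonal z * U) i i =
      (diagonal (fun i => (hA.eigenvalues i : ℂ)) * (Uᴴ * diagonal z * U)).trace := by
    simp [Matrix.trace, diagonal_mul]
  have h2 : ∑ k, A k k * z k = (A * diagonal z).trace := by
    simp [Matrix.trace, mul_diagonal]
  rw [h1, h2]
  conv_rhs => rw [hA']
  simp only [Matrix.mul_assoc]
  rw [Matrix.trace_mul_comm U]
  simp only [Matrix.mul_assoc]

/-- Both sides are maxima of the concave quadratic 2 Re Tr[A Y] - Tr[B Y Y*] - t Tr[A Y* Y]: the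
right one over all matrices, the left one over diagonal matrices only. It suffices to evaluate it at
the diagonal optimum and complete squares in the eigenbases. -/
theorem sum_sq_div_le_resolvent {A B : Matrix κ κ ℂ} (hA : A.PosSemidef) (hB : B.PosSemidef)
    {t : ℝ} (ht : 0 < t) :
    ∑ k, (A k k).re ^ 2 / ((B k k).re + t * (A k k).re) ≤
      ∑ ij : κ × κ, (hA.1.eigenvalues ij.1 * overlap hA.1 hB.1 ij.1 ij.2) ^ 2 /
        (hB.1.eigenvalues ij.2 * overlap hA.1 hB.1 ij.1 ij.2 +
          t * (hA.1.eigenvalues ij.1 * overlap hA.1 hB.1 ij.1 ij.2)) := by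
  set r : κ → ℝ := fun k => (A k k).re with hr
  set s : κ → ℝ := fun k => (B k k).re with hs
  have hr0 : ∀ k, 0 ≤ r k := fun k => re_diag_nonneg hA k
  have hs0 : ∀ k, 0 ≤ s k := fun k => re_diag_nonneg hB k
  -- The maximiser of `2 r x - (s + t r) x²`.
  set x : κ → ℝ := fun k => r k / (s k + t * r k) with hx
  set X : Matrix κ κ ℂ := diagonal fun k => (x k : ℂ) with hX
  have hXX : X * X = diagonal fun k => ((x k ^ 2 : ℝ) : ℂ) := by
    rw [hX, diagonal_mul_diagonal]
    congr 1; ext k; push_cast; ring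
  have hXH : Xᴴ = X := by
    rw [hX, diagonal_conjTranspose]
    congr 1; ext k; simp
  have hUU : (hA.1.eigenvectorUnitary : Matrix κ κ ℂ) * (hA.1.eigenvectorUnitary : Matrix κ κ ℂ)ᴴ
    = 1 := Unitary.coe_mul_star_self hA.1.eigenvectorUnitary
  have hVV : (hB.1.eigenvectorUnitary : Matrix κ κ ℂ) * (hB.1.eigenvectorUnitary : Matrix κ κ ℂ)ᴴ
    = 1 := Unitary.coe_mul_star_self hB.1.eigenvectorUnitary
  have tA := sum_eigenvalues_mul_conj_diagonal hA.1
  have tB := sum_eigenvalues_mul_conj_diagonal hB.1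
  have hover' : ∀ i j, overlap hA.1 hB.1 i j = ‖eigenbasisChange hA.1 hB.1 i j‖ ^ 2 :=
    fun i j => rfl
  set C : Matrix κ κ ℂ := eigenbasisChange hA.1 hB.1 with hC
  unfold eigenbasisChange at hC
  set U : Matrix κ κ ℂ := hA.1.eigenvectorUnitary.1
  set V : Matrix κ κ ℂ := hB.1.eigenvectorUnitary.1
  -- `X` with rows in the eigenbasis of `B` and columns in that of `A`; `s1`, `s2`, `s3` rewrite
  -- Tr[A X], Tr[A X²], Tr[B X²] through its entries.
  set Y : Matrix κ κ ℂ := Vᴴ * X * U with hY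
  have hYH : Yᴴ = Uᴴ * X * V := by
    rw [hY, conjTranspose_mul, conjTranspose_mul, conjTranspose_conjTranspose, hXH,
      Matrix.mul_assoc]
  have hCY : C * Y = Uᴴ * X * U := by
    calc C * Y = Uᴴ * (V * Vᴴ) * X * U := by rw [hC, hY]; simp only [Matrix.mul_assoc]
      _ = _ := by rw [hVV, Matrix.mul_one]
  have hYY : Yᴴ * Y = Uᴴ * (X * X) * U := by
    calc Yᴴ * Y = Uᴴ * X * (V * Vᴴ) * X * U := by rw [hYH, hY]; simp only [Matrix.mul_assoc]
      _ = _ := by rw [hVV, Matrix.mul_one]; simp only [Matrix.mul_assoc]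
  have hYY' : Y * Yᴴ = Vᴴ * (X * X) * V := by
    calc Y * Yᴴ = Vᴴ * X * (U * Uᴴ) * X * V := by rw [hYH, hY]; simp only [Matrix.mul_assoc]
      _ = _ := by rw [hUU, Matrix.mul_one]; simp only [Matrix.mul_assoc]
  have hnorm : ∀ j i, ((‖Y j i‖ ^ 2 : ℝ) : ℂ) = star (Y j i) * Y j i := by
    intro j i
    rw [← Complex.normSq_eq_norm_sq]
    exact Complex.normSq_eq_conj_mul_self
  have s1 : ∑ k, r k * x k = ∑ i, ∑ j, hA.1.eigenvalues i * (C i j * Y j i).re := by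
    have h1 : ((∑ k, r k * x k : ℝ) : ℂ) = ∑ i, ∑ j, (hA.1.eigenvalues i : ℂ) * (C i j * Y j i) := by
      have h2 := tA fun k => (x k : ℂ)
      rw [← hX, ← hCY] at h2
      simp only [Matrix.mul_apply, Finset.mul_sum] at h2
      rw [h2]
      push_cast
      exact Finset.sum_congr rfl fun k _ => by rw [hr]; simp only [ofReal_re_diag hA k]
    have h3 := congrArg Complex.re h1
    simpa only [Complex.ofReal_re, Complex.re_sum, Complex.re_ofReal_mul] using h3
  have s2 : ∑ k, r k * x k ^ 2 = ∑ i, ∑ j, hA.1.eigenvalues i * ‖Y j i‖ ^ 2 := by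
    have h2 := tA fun k => ((x k ^ 2 : ℝ) : ℂ)
    rw [← hXX, ← hYY] at h2
    simp only [Matrix.mul_apply, Finset.mul_sum, conjTranspose_apply, ← hnorm] at h2
    have h1 : ((∑ k, r k * x k ^ 2 : ℝ) : ℂ) =
        ((∑ i, ∑ j, hA.1.eigenvalues i * ‖Y j i‖ ^ 2 : ℝ) : ℂ) := by
      push_cast
      push_cast at h2
      rw [h2]
      exact Finset.sum_congr rfl fun k _ => by rw [hr]; simp only [ofReal_re_diag hA k]
    exact_mod_cast h1
  have s3 : ∑ k, s k * x k ^ 2 = ∑ i, ∑ j, hB.1.eigenvalues j * ‖Y j i‖ ^ 2 := by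
    have h2 := tB fun k => ((x k ^ 2 : ℝ) : ℂ)
    rw [← hXX, ← hYY'] at h2
    simp only [Matrix.mul_apply, Finset.mul_sum, conjTranspose_apply, mul_comm (Y _ _) (star _),
      ← hnorm] at h2
    rw [Finset.sum_comm] at h2
    have h1 : ((∑ k, s k * x k ^ 2 : ℝ) : ℂ) =
        ((∑ i, ∑ j, hB.1.eigenvalues j * ‖Y j i‖ ^ 2 : ℝ) : ℂ) := by
      push_cast
      push_cast at h2
      rw [h2]
      exact Finset.sum_congr rfl fun k _ => by rw [hs]; simp only [ofReal_re_diag hB k]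
    exact_mod_cast h1
  have pointwise : ∀ i j, 2 * (hA.1.eigenvalues i * (C i j * Y j i).re) ≤
      (hA.1.eigenvalues i * overlap hA.1 hB.1 i j) ^ 2 / (hB.1.eigenvalues j * overlap hA.1 hB.1 i j
        + t * (hA.1.eigenvalues i * overlap hA.1 hB.1 i j)) +
      (hB.1.eigenvalues j * ‖Y j i‖ ^ 2 + t * (hA.1.eigenvalues i * ‖Y j i‖ ^ 2)) := by
    intro i j
    rw [hover']
    have hl := hA.eigenvalues_nonneg i
    have hm := hB.eigenvalues_nonneg j
    have hre : (C i j * Y j i).re ≤ ‖C i j‖ * ‖Y j i‖ :=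
      (Complex.re_le_norm _).trans (norm_mul _ _).le
    generalize (C i j * Y j i).re = z at hre
    generalize hc : ‖C i j‖ = c at hre
    have hc0 : 0 ≤ c := hc ▸ norm_nonneg _
    generalize ‖Y j i‖ = y at hre
    generalize hA.1.eigenvalues i = l at hl
    generalize hB.1.eigenvalues j = m at hm
    have hle : 2 * (l * z) ≤ 2 * (l * (c * y)) := by gcongr
    refine hle.trans ?_
    rcases eq_or_lt_of_le hl with hl0 | hl0
    · rw [← hl0]; simp; positivity
    rcases eq_or_lt_of_le hc0 with hc0 | hc0
    · rw [← hc0]; simp; positivity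
    have hD : 0 < m + t * l := by positivity
    have h1 : (l * c ^ 2) ^ 2 / (m * c ^ 2 + t * (l * c ^ 2)) = (l * c) ^ 2 / (m + t * l) := by
      rw [show m * c ^ 2 + t * (l * c ^ 2) = (m + t * l) * c ^ 2 by ring]
      field_simp
    rw [h1]
    have h2 : (l * c) ^ 2 / (m + t * l) + (m * y ^ 2 + t * (l * y ^ 2)) - 2 * (l * (c * y)) =
        (l * c - (m + t * l) * y) ^ 2 / (m + t * l) := by
      field_simp
      ring
    have h3 : 0 ≤ (l * c - (m + t * l) * y) ^ 2 / (m + t * l) := by positivity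
    linarith
  have total := Finset.sum_le_sum fun i (_ : i ∈ Finset.univ) =>
    Finset.sum_le_sum fun j (_ : j ∈ Finset.univ) => pointwise i j
  simp only [Finset.sum_add_distrib, ← Finset.mul_sum] at total
  simp only [Finset.mul_sum] at total
  rw [Fintype.sum_prod_type]
  have s1' : ∑ i, ∑ j, 2 * (hA.1.eigenvalues i * (C i j * Y j i).re) = 2 * ∑ k, r k * x k := by
    rw [s1]; simp only [Finset.mul_sum]
  have s2' : ∑ i, ∑ j, t * (hA.1.eigenvalues i * ‖Y j i‖ ^ 2) = t * ∑ k, r k * x k ^ 2 := by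
    rw [s2]; simp only [Finset.mul_sum]
  rw [s1', s2', ← s3] at total
  have hfin : ∑ k, r k ^ 2 / (s k + t * r k) =
      2 * ∑ k, r k * x k - (∑ k, s k * x k ^ 2 + t * ∑ k, r k * x k ^ 2) := by
    simp only [Finset.mul_sum, ← Finset.sum_add_distrib, ← Finset.sum_sub_distrib]
    refine Finset.sum_congr rfl fun k _ => ?_
    rcases eq_or_lt_of_le (hr0 k) with h0 | h0
    · simp [hx, ← h0]
    · have : 0 < s k + t * r k := by have := hs0 k; positivity
      simp only [hx]
      field_simp
      ring
  rw [hfin]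
  linarith

/-- Monotonicity of the relative entropy `Tr[A (log A - log B)]` under the measurement in the
standard basis, for `A ≤ B`. -/
theorem relEntropy_diag_le {A B : Matrix κ κ ℂ} (hA : A.PosSemidef) (hB : B.PosSemidef)
    (hAB : (B - A).PosSemidef) :
    ∑ k, (A k k).re * Real.logb 2 ((A k k).re / (B k k).re) ≤
      (A * cfc (Real.logb 2) A).trace.re - (A * cfc (Real.logb 2) B).trace.re := by
  -- `A ≤ B` serves only to supply the two support conditions.
  have hle : ∀ k, (A k k).re ≤ (B k k).re := fun k => by
    have := re_diag_nonneg hAB k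
    simpa using this
  have hdeg : ∀ i j, hB.1.eigenvalues j = 0 → hA.1.eigenvalues i * overlap hA.1 hB.1 i j = 0 :=
    fun i j hj => overlap_mul_eigenvalue_eq_zero hA hB.1 hAB hj
  -- The weights `λᵢ wᵢⱼ` and `μⱼ wᵢⱼ`, with `w` the overlaps, have the quantum relative entropy of
  -- `A` and `B` as their classical one.
  have h := sum_mul_log_div_le_of_resolvent
    (p := fun ij : κ × κ => hA.1.eigenvalues ij.1 * overlap hA.1 hB.1 ij.1 ij.2)
    (q := fun ij : κ × κ => hB.1.eigenvalues ij.2 * overlap hA.1 hB.1 ij.1 ij.2)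
    (r := fun k => (A k k).re) (s := fun k => (B k k).re)
    (fun ij => mul_nonneg (hA.eigenvalues_nonneg _) (overlap_nonneg _ _ _ _))
    (fun ij => mul_nonneg (hB.eigenvalues_nonneg _) (overlap_nonneg _ _ _ _))
    (re_diag_nonneg hA) (re_diag_nonneg hB)
    (fun ij h0 => by
      rcases mul_eq_zero.1 h0 with h0 | h0
      · exact hdeg _ _ h0
      · simp [h0])
    (fun k h0 => le_antisymm (h0 ▸ hle k) (re_diag_nonneg hA k))
    (by
      rw [Fintype.sum_prod_type]
      simp only [← Finset.mul_sum, sum_overlap_left, mul_one]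
      have := congrArg Complex.re hA.1.trace_eq_sum_eigenvalues
      simp only [Matrix.trace, diag_apply, Complex.re_sum] at this
      rw [this]
      rfl)
    (fun t ht => sum_sq_div_le_resolvent hA hB ht)
  rw [trace_mul_log_sub_log hA.1 hB.1]
  simp only [Real.logb, ← sub_div, ← mul_div_assoc, ← Finset.sum_div]
  refine div_le_div_of_nonneg_right (h.trans_eq ?_) (Real.log_nonneg (by norm_num))
  rw [Fintype.sum_prod_type]
  refine Finset.sum_congr rfl fun i _ => Finset.sum_congr rfl fun j _ => ?_
  by_cases h0 : hA.1.eigenvalues i * overlap hA.1 hB.1 i j = 0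
  · simp only [h0, zero_mul]
    rw [← mul_assoc, mul_comm (overlap _ _ _ _), h0, zero_mul]
  · have hm : hB.1.eigenvalues j ≠ 0 := fun h => h0 (hdeg i j h)
    have hl := left_ne_zero_of_mul h0
    rw [mul_div_mul_right _ _ (right_ne_zero_of_mul h0), Real.log_div hl hm]
    ring

/-- The sum `W` is ⟨u, B⁻¹ u⟩ for the `i`-th eigenvector `u` of `A`, with the pseudo-inverse.
Testing `A ≤ B` on `B⁻¹ u` gives `λ W² ≤ W`. -/
theorem eigenvalue_mul_sum_overlap_div_le {A B : Matrix κ κ ℂ} (hA : A.PosSemidef)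
    (hB : B.PosSemidef) (hAB : (B - A).PosSemidef) (i : κ) :
    hA.1.eigenvalues i * ∑ j, overlap hA.1 hB.1 i j / hB.1.eigenvalues j ≤ 1 := by
  have hP := posSemidef_diagonal_sub hA.1 hB.1 hAB
  have hover := ofReal_overlap hA.1 hB.1
  set C := eigenbasisChange hA.1 hB.1
  set W := ∑ j, overlap hA.1 hB.1 i j / hB.1.eigenvalues j with hW
  have hW0 : 0 ≤ W := Finset.sum_nonneg fun j _ =>
    div_nonneg (overlap_nonneg _ _ _ _) (hB.eigenvalues_nonneg j)
  -- The coordinates of `B⁻¹ u` in the eigenbasis of `B`; zero eigenvalues contribute 0.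
  set z : κ → ℂ := fun j => star (C i j) * ((hB.1.eigenvalues j)⁻¹ : ℝ) with hz
  have h1 := hP.dotProduct_mulVec_nonneg z
  rw [Matrix.sub_mulVec, dotProduct_sub, sub_nonneg, ← Matrix.mulVec_mulVec,
    ← Matrix.mulVec_mulVec, Matrix.dotProduct_mulVec (star z) Cᴴ, ← Matrix.star_mulVec] at h1
  have h2 : star z ⬝ᵥ (diagonal fun j => (hB.1.eigenvalues j : ℂ)) *ᵥ z = (W : ℂ) := by
    simp only [dotProduct, mulVec_diagonal, Pi.star_apply, hW, Complex.ofReal_sum]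
    refine Finset.sum_congr rfl fun j _ => ?_
    rw [Complex.ofReal_div, hover]
    simp only [hz, star_mul', Complex.star_def, Complex.conj_ofReal, Complex.conj_conj]
    by_cases h0 : hB.1.eigenvalues j = 0
    · simp [h0]
    · have : (hB.1.eigenvalues j : ℂ) ≠ 0 := by exact_mod_cast h0
      push_cast
      field_simp
  have h3 : (C *ᵥ z) i = (W : ℂ) := by
    simp only [mulVec, dotProduct, hW, Complex.ofReal_sum]
    refine Finset.sum_congr rfl fun j _ => ?_
    rw [Complex.ofReal_div, hover]
    simp only [hz]
    push_cast
    ring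
  have h4 : star (C *ᵥ z) ⬝ᵥ (diagonal fun j => (hA.1.eigenvalues j : ℂ)) *ᵥ (C *ᵥ z) =
      ((∑ l, hA.1.eigenvalues l * ‖(C *ᵥ z) l‖ ^ 2 : ℝ) : ℂ) := by
    simp only [dotProduct, mulVec_diagonal, Pi.star_apply, Complex.ofReal_sum]
    refine Finset.sum_congr rfl fun l _ => ?_
    rw [Complex.ofReal_mul, ← Complex.normSq_eq_norm_sq, Complex.normSq_eq_conj_mul_self]
    simp only [Complex.star_def]
    ring
  rw [h2, h4, Complex.real_le_real] at h1
  have h5 : hA.1.eigenvalues i * W ^ 2 ≤ W := by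
    refine le_trans ?_ h1
    have := Finset.single_le_sum (f := fun l => hA.1.eigenvalues l * ‖(C *ᵥ z) l‖ ^ 2)
      (fun l _ => mul_nonneg (hA.eigenvalues_nonneg l) (by positivity)) (Finset.mem_univ i)
    simpa [h3] using this
  rcases eq_or_lt_of_le hW0 with h0 | h0
  · simp [← h0]
  · have : hA.1.eigenvalues i * W * W ≤ 1 * W := by nlinarith
    exact le_of_mul_le_mul_right this h0

/-- `Tr[A (log A - log B)] ≤ 0` for `A ≤ B`. -/
theorem relEntropy_nonpos {A B : Matrix κ κ ℂ} (hA : A.PosSemidef) (hB : B.PosSemidef)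
    (hAB : (B - A).PosSemidef) :
    (A * cfc (Real.logb 2) A).trace.re - (A * cfc (Real.logb 2) B).trace.re ≤ 0 := by
  rw [trace_mul_log_sub_log hA.1 hB.1]
  refine Finset.sum_nonpos fun i _ => ?_
  simp only [Real.logb, ← sub_div, ← mul_div_assoc, ← Finset.sum_div]
  refine div_nonpos_of_nonpos_of_nonneg ?_ (Real.log_nonneg (by norm_num))
  have hl := hA.eigenvalues_nonneg i
  -- From `log x ≤ x - 1` at the ratio of the eigenvalues. This route needs no operator monotonicity
  -- of the logarithm.
  have key : ∀ j, overlap hA.1 hB.1 i j * (hA.1.eigenvalues i *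
      (Real.log (hA.1.eigenvalues i) - Real.log (hB.1.eigenvalues j))) ≤
      hA.1.eigenvalues i * (hA.1.eigenvalues i * (overlap hA.1 hB.1 i j / hB.1.eigenvalues j)
        - overlap hA.1 hB.1 i j) := by
    intro j
    have hw := overlap_nonneg hA.1 hB.1 i j
    by_cases h0 : hA.1.eigenvalues i * overlap hA.1 hB.1 i j = 0
    · rcases mul_eq_zero.1 h0 with h0 | h0 <;> simp [h0]
    · have hm : 0 < hB.1.eigenvalues j := lt_of_le_of_ne (hB.eigenvalues_nonneg j) fun h =>
        h0 (overlap_mul_eigenvalue_eq_zero hA hB.1 hAB h.symm)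
      have hl' : 0 < hA.1.eigenvalues i := lt_of_le_of_ne hl (left_ne_zero_of_mul h0).symm
      have h1 := Real.log_le_sub_one_of_pos (div_pos hl' hm)
      rw [Real.log_div hl'.ne' hm.ne'] at h1
      calc _ = hA.1.eigenvalues i * overlap hA.1 hB.1 i j *
            (Real.log (hA.1.eigenvalues i) - Real.log (hB.1.eigenvalues j)) := by ring
        _ ≤ hA.1.eigenvalues i * overlap hA.1 hB.1 i j *
            (hA.1.eigenvalues i / hB.1.eigenvalues j - 1) := by gcongr
        _ = _ := by ring
  refine (Finset.sum_le_sum fun j _ => key j).trans ?_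
  rw [← Finset.mul_sum, Finset.sum_sub_distrib, ← Finset.mul_sum, sum_overlap_left]
  exact mul_nonpos_of_nonneg_of_nonpos hl
    (sub_nonpos.2 (eigenvalue_mul_sum_overlap_div_le hA hB hAB i))

/-- All spectra involved are finite, so one interpolating polynomial replaces `f` everywhere, and
polynomials act blockwise. -/
theorem cfc_blockDiagonal {o : Type*} [Fintype o] [DecidableEq o] {A : o → Matrix κ κ ℂ}
    (hA : ∀ a, (A a).IsHermitian) (f : ℝ → ℝ) :
    cfc f (blockDiagonal A) = blockDiagonal fun a => cfc f (A a) := by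
  classical
  have hbd : (blockDiagonal A).IsHermitian := by
    rw [IsHermitian, blockDiagonal_conjTranspose]
    congr 1; ext1 a; exact hA a
  have hfin : ((⋃ a, spectrum ℝ (A a)) ∪ spectrum ℝ (blockDiagonal A)).Finite :=
    (Set.finite_iUnion fun a => Matrix.finite_real_spectrum).union Matrix.finite_real_spectrum
  set T := hfin.toFinset
  set p : Polynomial ℝ := Lagrange.interpolate T id f
  have hp : ∀ x ∈ T, f x = p.eval x := fun x hx =>
    (Lagrange.eval_interpolate_at_node f Function.injective_id.injOn hx).symm
  have h1 : cfc f (blockDiagonal A) = Polynomial.aeval (blockDiagonal A) p := by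
    rw [← cfc_polynomial p (blockDiagonal A) hbd.isSelfAdjoint]
    exact cfc_congr fun x hx => hp x (hfin.mem_toFinset.2 (Or.inr hx))
  have h2 : ∀ a, cfc f (A a) = Polynomial.aeval (A a) p := fun a => by
    rw [← cfc_polynomial p (A a) (hA a).isSelfAdjoint]
    exact cfc_congr fun x hx =>
      hp x (hfin.mem_toFinset.2 (Or.inl (Set.mem_iUnion.2 ⟨a, hx⟩)))
  rw [h1]
  simp only [h2]
  induction p using Polynomial.induction_on' with
  | add p q hp hq =>
    simp only [map_add, hp, hq, ← blockDiagonal_add]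
    rfl
  | monomial k c =>
    simp only [Polynomial.aeval_monomial, ← blockDiagonal_pow, Algebra.algebraMap_eq_smul_one,
      smul_mul_assoc, one_mul, ← blockDiagonal_smul]
    rfl

theorem vonNeumannEntropy_blockDiagonal {o : Type*} [Fintype o] [DecidableEq o]
    {A : o → Matrix κ κ ℂ} (hA : ∀ a, (A a).IsHermitian) :
    vonNeumannEntropy (blockDiagonal A) = ∑ a, vonNeumannEntropy (A a) := by
  unfold vonNeumannEntropy
  rw [cfc_blockDiagonal hA, ← blockDiagonal_mul, trace_blockDiagonal, Complex.re_sum,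
    Finset.sum_neg_distrib]

/-- Turns H(X|E) into relative entropies of each block to the sum of the blocks, which dominates it.
-/
theorem entropy_blockDiagonal_sub {o : Type*} [Fintype o] [DecidableEq o]
    {A : o → Matrix κ κ ℂ} (hA : ∀ a, (A a).PosSemidef) :
    vonNeumannEntropy (blockDiagonal A) - vonNeumannEntropy (∑ a, A a) =
      -∑ a, ((A a * cfc (Real.logb 2) (A a)).trace.re -
        (A a * cfc (Real.logb 2) (∑ b, A b)).trace.re) := by
  rw [vonNeumannEntropy_blockDiagonal fun a => (hA a).1]
  unfold vonNeumannEntropy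
  rw [Finset.sum_mul, Matrix.trace_sum, Complex.re_sum, Finset.sum_sub_distrib,
    Finset.sum_neg_distrib]
  ring

/-- For a classical-quantum state, measuring the quantum system does not decrease the conditional
entropy of the classical register. -/
theorem entropy_blockDiagonal_sub_le {o : Type*} [Fintype o] [DecidableEq o]
    {A : o → Matrix κ κ ℂ} (hA : ∀ a, (A a).PosSemidef) :
    vonNeumannEntropy (blockDiagonal A) - vonNeumannEntropy (∑ a, A a) ≤
      -∑ a, ∑ k, (A a k k).re * Real.logb 2 ((A a k k).re / ∑ b, (A b k k).re) := by
  rw [entropy_blockDiagonal_sub hA]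
  refine neg_le_neg (Finset.sum_le_sum fun a _ => ?_)
  have := relEntropy_diag_le (hA a) (posSemidef_sum _ fun b _ => hA b) (posSemidef_sum_sub hA a)
  simpa only [Matrix.sum_apply, Complex.re_sum] using this

theorem entropy_blockDiagonal_sub_nonneg {o : Type*} [Fintype o] [DecidableEq o]
    {A : o → Matrix κ κ ℂ} (hA : ∀ a, (A a).PosSemidef) :
    0 ≤ vonNeumannEntropy (blockDiagonal A) - vonNeumannEntropy (∑ a, A a) := by
  rw [entropy_blockDiagonal_sub hA, neg_nonneg]
  exact Finset.sum_nonpos fun a _ =>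
    relEntropy_nonpos (hA a) (posSemidef_sum _ fun b _ => hA b) (posSemidef_sum_sub hA a)

end Pinching

/-! ### Classical conditional entropy under conditional independence -/

section Markov

/-- If `X` and `Y` are independent given `K`, then `H(X|K) ≤ H(X|Y)`. -/
theorem condEntropy_le_of_markov {α β κ : Type*} [Fintype α] [Fintype β] [Fintype κ]
    {p : α → β → κ → ℝ} (hp : ∀ a b e, 0 ≤ p a b e)
    (hM : ∀ a b e, p a b e * ∑ a', ∑ b', p a' b' e = (∑ b', p a b' e) * ∑ a', p a' b e) :
    -∑ a, ∑ e, (∑ b, p a b e) * Real.logb 2 ((∑ b, p a b e) / ∑ a', ∑ b, p a' b e) ≤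
      shannonEntropy (fun ab : α × β => ∑ e, p ab.1 ab.2 e) -
        shannonEntropy (fun b => ∑ a, ∑ e, p a b e) := by
  have hrhs : shannonEntropy (fun ab : α × β => ∑ e, p ab.1 ab.2 e) -
      shannonEntropy (fun b => ∑ a, ∑ e, p a b e) =
      -∑ a, ∑ b, (∑ e, p a b e) * Real.logb 2 ((∑ e, p a b e) / ∑ e, ∑ a', p a' b e) := by
    unfold shannonEntropy
    have h1 : ∑ b, (∑ a, ∑ e, p a b e) * Real.logb 2 (∑ a, ∑ e, p a b e) =
        ∑ a, ∑ b, (∑ e, p a b e) * Real.logb 2 (∑ a, ∑ e, p a b e) := by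
      rw [Finset.sum_comm]
      simp only [Finset.sum_mul]
    rw [Fintype.sum_prod_type, h1, sub_neg_eq_add, neg_add_eq_sub, ← neg_sub,
      ← Finset.sum_sub_distrib]
    congr 1
    refine Finset.sum_congr rfl fun a _ => ?_
    rw [← Finset.sum_sub_distrib]
    refine Finset.sum_congr rfl fun b _ => ?_
    rw [Finset.sum_comm (f := fun e a' => p a' b e)]
    by_cases h0 : ∑ e, p a b e = 0
    · simp [h0]
    · have h2 : ∑ a', ∑ e, p a' b e ≠ 0 := fun h => h0 <|
        (Finset.sum_eq_zero_iff_of_nonneg fun a' _ =>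
          Finset.sum_nonneg fun e _ => hp a' b e).1 h a (Finset.mem_univ a)
      rw [Real.logb_div h0 h2]
      ring
  rw [hrhs]
  refine neg_le_neg ?_
  -- Independence gives p(a|e) = p(a|b,e) wherever p(a,b,e) > 0, so H(X|K) = H(X|KY).
  have hlhs : ∑ a, ∑ e, (∑ b, p a b e) * Real.logb 2 ((∑ b, p a b e) / ∑ a', ∑ b, p a' b e) =
      ∑ a, ∑ b, ∑ e, p a b e * Real.logb 2 (p a b e / ∑ a', p a' b e) := by
    refine Finset.sum_congr rfl fun a _ => ?_
    rw [Finset.sum_comm]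
    refine Finset.sum_congr rfl fun e _ => ?_
    rw [Finset.sum_mul]
    refine Finset.sum_congr rfl fun b _ => ?_
    rcases eq_or_lt_of_le (hp a b e) with h0 | h0
    · simp [← h0]
    have h1 : 0 < ∑ a', p a' b e := Finset.sum_pos' (fun a' _ => hp a' b e) ⟨a, Finset.mem_univ a, h0⟩
    have h2 : 0 < ∑ a', ∑ b', p a' b' e :=
      Finset.sum_pos' (fun a' _ => Finset.sum_nonneg fun b' _ => hp a' b' e) ⟨a, Finset.mem_univ a,
        Finset.sum_pos' (fun b' _ => hp a b' e) ⟨b, Finset.mem_univ b, h0⟩⟩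
    congr 2
    rw [div_eq_div_iff h2.ne' h1.ne']
    exact (hM a b e).symm
  rw [hlhs]
  refine Finset.sum_le_sum fun a _ => Finset.sum_le_sum fun b _ => ?_
  -- For fixed `a` and `b`, the log-sum inequality over `e` forgets `K`.
  exact sum_mul_logb_div_le (fun e => hp a b e) (fun e => Finset.sum_nonneg fun a' _ => hp a' b e)
    fun e h => (Finset.sum_eq_zero_iff_of_nonneg fun a' _ => hp a' b e).1 h a (Finset.mem_univ a)

end Markov

/-! ### Tensor products over the parties and across a bipartition -/

section TensorLemmas

open scoped MatrixOrder in
theorem exists_eq_conjTranspose_mul {κ : Type*} [Fintype κ] {A : Matrix κ κ ℂ}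
    (hA : A.PosSemidef) : ∃ M : Matrix κ κ ℂ, A = Mᴴ * M := by
  classical
  exact CStarAlgebra.nonneg_iff_eq_star_mul_self.1 hA.nonneg

theorem trace_mul_nonneg {κ : Type*} [Fintype κ] {A B : Matrix κ κ ℂ}
    (hA : A.PosSemidef) (hB : B.PosSemidef) : 0 ≤ (A * B).trace := by
  obtain ⟨M, rfl⟩ := exists_eq_conjTranspose_mul hA
  rw [Matrix.mul_assoc, Matrix.trace_mul_comm]
  exact (hB.mul_mul_conjTranspose_same M).trace_nonneg

variable {ι : Type*} {H : ι → Type*}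

theorem conjTranspose_bipartiteTensor (S : Finset ι)
    (A : Matrix (∀ i : {i // i ∈ S}, H i) (∀ i : {i // i ∈ S}, H i) ℂ)
    (B : Matrix (∀ i : {i // i ∉ S}, H i) (∀ i : {i // i ∉ S}, H i) ℂ) :
    (bipartiteTensor S A B)ᴴ = bipartiteTensor S Aᴴ Bᴴ := by
  ext f g
  simp [bipartiteTensor, conjTranspose_apply]

theorem bipartiteTensor_pureState (S : Finset ι) (φ : (∀ i : {i // i ∈ S}, H i) → ℂ)
    (χ : (∀ i : {i // i ∉ S}, H i) → ℂ) :
    bipartiteTensor S (pureState φ) (pureState χ) =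
      pureState fun f : ∀ i, H i => φ (fun i => f i) * χ (fun i => f i) := by
  ext f g
  simp only [bipartiteTensor, pureState, vecMulVec_apply, of_apply, Pi.star_apply, star_mul']
  ring

variable [Fintype ι]

theorem conjTranspose_tensor (A : ∀ i, Matrix (H i) (H i) ℂ) :
    (tensor A)ᴴ = tensor fun i => (A i)ᴴ := by
  ext f g
  simp [tensor, conjTranspose_apply]

theorem tensor_one [∀ i, DecidableEq (H i)] :
    tensor (fun i => (1 : Matrix (H i) (H i) ℂ)) = 1 := by
  ext f g
  simp only [tensor, of_apply, one_apply]
  rw [Finset.prod_ite_zero]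
  simp [funext_iff]

variable [DecidableEq ι]

theorem tensor_update_sum {β : Type*} [Fintype β] (C : ∀ i, Matrix (H i) (H i) ℂ) (i : ι)
    (X : β → Matrix (H i) (H i) ℂ) :
    ∑ b, tensor (Function.update C i (X b)) = tensor (Function.update C i (∑ b, X b)) := by
  ext f g
  have h : ∀ Y : Matrix (H i) (H i) ℂ, tensor (Function.update C i Y) f g =
      Y (f i) (g i) * ∏ j ∈ Finset.univ.erase i, C j (f j) (g j) := by
    intro Y
    simp only [tensor, of_apply]
    rw [← Finset.mul_prod_erase _ _ (Finset.mem_univ i), Function.update_self]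
    congr 1
    refine Finset.prod_congr rfl fun j hj => ?_
    rw [Function.update_of_ne (Finset.ne_of_mem_erase hj)]
  rw [Matrix.sum_apply, h]
  simp only [h, Matrix.sum_apply, Finset.sum_mul]

theorem sum_tensor_piFinset {O : ι → Type*} (G : ∀ i, O i → Matrix (H i) (H i) ℂ)
    (s : ∀ i, Finset (O i)) :
    ∑ o ∈ Fintype.piFinset s, tensor (fun i => G i (o i)) = tensor fun i => ∑ b ∈ s i, G i b := by
  ext f g
  simp only [Matrix.sum_apply, tensor, of_apply]
  rw [Finset.prod_univ_sum]

theorem tensor_eq_bipartiteTensor (S : Finset ι) (C : ∀ i, Matrix (H i) (H i) ℂ) :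
    tensor C = bipartiteTensor S (tensor fun i : {i // i ∈ S} => C i)
      (tensor fun i : {i // i ∉ S} => C i) := by
  ext f g
  simp only [tensor, bipartiteTensor, of_apply]
  rw [← Fintype.prod_subtype_mul_prod_subtype (fun i => i ∈ S) fun i => C i (f i) (g i)]
  congr!

variable [∀ i, Fintype (H i)]

theorem tensor_mul (A B : ∀ i, Matrix (H i) (H i) ℂ) :
    tensor A * tensor B = tensor fun i => A i * B i := by
  classical
  ext f g
  simp only [tensor, of_apply, Matrix.mul_apply, ← Finset.prod_mul_distrib]
  rw [Finset.prod_univ_sum, Fintype.piFinset_univ]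

theorem posSemidef_tensor {A : ∀ i, Matrix (H i) (H i) ℂ} (hA : ∀ i, (A i).PosSemidef) :
    (tensor A).PosSemidef := by
  choose M hM using fun i => exists_eq_conjTranspose_mul (hA i)
  have h : tensor A = (tensor M)ᴴ * tensor M := by
    rw [conjTranspose_tensor, tensor_mul]
    congr 1; ext1 i; exact hM i
  rw [h]
  exact posSemidef_conjTranspose_mul_self _

theorem sum_bipartite (S : Finset ι) (F : (∀ i : {i // i ∈ S}, H i) → ℂ)
    (G : (∀ i : {i // i ∉ S}, H i) → ℂ) :
    ∑ f : ∀ i, H i, F (fun i => f i) * G (fun i => f i) = (∑ u, F u) * ∑ v, G v := by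
  rw [Finset.sum_mul_sum, ← Fintype.sum_prod_type']
  exact Fintype.sum_equiv (Equiv.piEquivPiSubtypeProd (fun i => i ∈ S) H) _ _ fun f => rfl

theorem trace_bipartiteTensor (S : Finset ι)
    (A : Matrix (∀ i : {i // i ∈ S}, H i) (∀ i : {i // i ∈ S}, H i) ℂ)
    (B : Matrix (∀ i : {i // i ∉ S}, H i) (∀ i : {i // i ∉ S}, H i) ℂ) :
    (bipartiteTensor S A B).trace = A.trace * B.trace :=
  sum_bipartite S (fun u => A u u) fun v => B v v

theorem bipartiteTensor_mul (S : Finset ι)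
    (A A' : Matrix (∀ i : {i // i ∈ S}, H i) (∀ i : {i // i ∈ S}, H i) ℂ)
    (B B' : Matrix (∀ i : {i // i ∉ S}, H i) (∀ i : {i // i ∉ S}, H i) ℂ) :
    bipartiteTensor S A B * bipartiteTensor S A' B' = bipartiteTensor S (A * A') (B * B') := by
  ext f g
  simp only [bipartiteTensor, of_apply, Matrix.mul_apply]
  rw [← sum_bipartite S (fun u => A (fun i => f i) u * A' u (fun i => g i))
    fun v => B (fun i => f i) v * B' v (fun i => g i)]
  exact Finset.sum_congr rfl fun _ _ => by ring

theorem posSemidef_bipartiteTensor (S : Finset ι)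
    {A : Matrix (∀ i : {i // i ∈ S}, H i) (∀ i : {i // i ∈ S}, H i) ℂ}
    {B : Matrix (∀ i : {i // i ∉ S}, H i) (∀ i : {i // i ∉ S}, H i) ℂ}
    (hA : A.PosSemidef) (hB : B.PosSemidef) : (bipartiteTensor S A B).PosSemidef := by
  obtain ⟨M, rfl⟩ := exists_eq_conjTranspose_mul hA
  obtain ⟨N, rfl⟩ := exists_eq_conjTranspose_mul hB
  rw [← bipartiteTensor_mul, ← conjTranspose_bipartiteTensor]
  exact posSemidef_conjTranspose_mul_self _

theorem isState_bipartiteTensor (S : Finset ι)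
    {A : Matrix (∀ i : {i // i ∈ S}, H i) (∀ i : {i // i ∈ S}, H i) ℂ}
    {B : Matrix (∀ i : {i // i ∉ S}, H i) (∀ i : {i // i ∉ S}, H i) ℂ}
    (hA : IsState A) (hB : IsState B) : IsState (bipartiteTensor S A B) :=
  ⟨posSemidef_bipartiteTensor S hA.1 hB.1, by rw [trace_bipartiteTensor, hA.2, hB.2, one_mul]⟩

theorem IsSeparable.isState {S : Finset ι} {σ : Matrix (∀ i, H i) (∀ i, H i) ℂ}
    (hσ : IsSeparable S σ) : IsState σ := by
  obtain ⟨m, q, A, B, hq, hq1, hA, hB, rfl⟩ := hσ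
  refine ⟨posSemidef_sum _ fun j _ => (posSemidef_bipartiteTensor S (hA j).1 (hB j).1).smul
    (by exact_mod_cast hq j), ?_⟩
  rw [Matrix.trace_sum]
  simp only [Matrix.trace_smul, (isState_bipartiteTensor S (hA _) (hB _)).2, smul_eq_mul, mul_one]
  exact_mod_cast hq1

/-- Local operators on the two sides of a partition are uncorrelated in a product state. -/
theorem trace_tensor_update_mul_bipartiteTensor [∀ i, DecidableEq (H i)] (S : Finset ι) {i j : ι}
    (hij : i ∈ S ↔ j ∉ S)
    (A : Matrix (∀ i : {i // i ∈ S}, H i) (∀ i : {i // i ∈ S}, H i) ℂ)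
    (B : Matrix (∀ i : {i // i ∉ S}, H i) (∀ i : {i // i ∉ S}, H i) ℂ)
    (X : Matrix (H i) (H i) ℂ) (Y : Matrix (H j) (H j) ℂ) :
    (tensor (Function.update (Function.update (fun i => (1 : Matrix (H i) (H i) ℂ)) i X) j Y) *
        bipartiteTensor S A B).trace * (bipartiteTensor S A B).trace =
      (tensor (Function.update (fun i => (1 : Matrix (H i) (H i) ℂ)) i X) *
        bipartiteTensor S A B).trace *
      (tensor (Function.update (fun i => (1 : Matrix (H i) (H i) ℂ)) j Y) *
        bipartiteTensor S A B).trace := by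
  have hne : i ≠ j := by rintro rfl; tauto
  -- With the trace written as the expectation of the identity, one factorisation across the cut
  -- handles all four traces; no normalisation of `A` and `B` is needed.
  have h1 : (bipartiteTensor S A B).trace =
      (tensor (fun i => (1 : Matrix (H i) (H i) ℂ)) * bipartiteTensor S A B).trace := by
    rw [tensor_one, Matrix.one_mul]
  rw [h1]
  have h2 : ∀ C : ∀ i, Matrix (H i) (H i) ℂ, (tensor C * bipartiteTensor S A B).trace =
      ((tensor fun i : {i // i ∈ S} => C i) * A).trace *
        ((tensor fun i : {i // i ∉ S} => C i) * B).trace := fun C => by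
    rw [tensor_eq_bipartiteTensor S C, bipartiteTensor_mul, trace_bipartiteTensor]
  simp only [h2]
  have upd : ∀ (C : ∀ i, Matrix (H i) (H i) ℂ) (l : ι) (Z : Matrix (H l) (H l) ℂ),
      l ∉ S → (fun i : {i // i ∈ S} => Function.update C l Z i) = fun i : {i // i ∈ S} => C i := by
    intro C l Z hl
    ext1 i
    exact Function.update_of_ne (fun h => hl (by rw [← h]; exact i.2)) _ _
  have upd' : ∀ (C : ∀ i, Matrix (H i) (H i) ℂ) (l : ι) (Z : Matrix (H l) (H l) ℂ),
      l ∈ S → (fun i : {i // i ∉ S} => Function.update C l Z i) = fun i : {i // i ∉ S} => C i := by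
    intro C l Z hl
    ext1 i
    exact Function.update_of_ne (fun h => i.2 (by rw [h]; exact hl)) _ _
  have hcomm := Function.update_comm hne X Y (fun i => (1 : Matrix (H i) (H i) ℂ))
  by_cases hi : i ∈ S
  · have hj := hij.1 hi
    rw [upd _ j Y hj, hcomm, upd' _ i X hi, upd' _ i X hi, upd _ j Y hj]
    ring
  · have hj : j ∈ S := by tauto
    rw [upd' _ j Y hj, hcomm, upd _ i X hi, upd _ i X hi, upd' _ j Y hj]
    ring

/-- A separable state is a sum of (unnormalised) pure product states. -/
theorem IsSeparable.exists_pure {S : Finset ι} {σ : Matrix (∀ i, H i) (∀ i, H i) ℂ}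
    (hσ : IsSeparable S σ) :
    ∃ (k : ℕ) (φ : Fin k → (∀ i : {i // i ∈ S}, H i) → ℂ)
      (χ : Fin k → (∀ i : {i // i ∉ S}, H i) → ℂ),
      σ = ∑ e, bipartiteTensor S (pureState (φ e)) (pureState (χ e)) := by
  obtain ⟨m, q, A, B, hq, -, hA, hB, rfl⟩ := hσ
  choose M hM using fun j => exists_eq_conjTranspose_mul (hA j).1
  choose N hN using fun j => exists_eq_conjTranspose_mul (hB j).1
  let E := Fin m × (∀ i : {i // i ∈ S}, H i) × (∀ i : {i // i ∉ S}, H i)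
  -- With A = MᴴM and B = NᴴN, the conjugated rows of `M` and `N` are the pure components; the
  -- weight `q` enters as a square root in the first factor.
  refine ⟨Fintype.card E, fun e f => (Real.sqrt (q ((Fintype.equivFin E).symm e).1) : ℂ) *
      star (M ((Fintype.equivFin E).symm e).1 ((Fintype.equivFin E).symm e).2.1 f),
    fun e g => star (N ((Fintype.equivFin E).symm e).1 ((Fintype.equivFin E).symm e).2.2 g), ?_⟩
  rw [(Fintype.equivFin E).symm.sum_comp fun e : E => bipartiteTensor S
    (pureState fun f => (Real.sqrt (q e.1) : ℂ) * star (M e.1 e.2.1 f))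
    (pureState fun g => star (N e.1 e.2.2 g)), Fintype.sum_prod_type]
  refine Finset.sum_congr rfl fun j _ => ?_
  rw [Fintype.sum_prod_type, hM j, hN j]
  ext f g
  have hs : (Real.sqrt (q j) : ℂ) * (Real.sqrt (q j) : ℂ) = (q j : ℂ) := by
    rw [← Complex.ofReal_mul, Real.mul_self_sqrt (hq j)]
  simp only [bipartiteTensor, pureState, Matrix.smul_apply, Matrix.sum_apply, of_apply,
    vecMulVec_apply, Pi.star_apply, Matrix.mul_apply, conjTranspose_apply, star_mul',
    Complex.star_def, Complex.conj_ofReal, Complex.conj_conj, smul_eq_mul]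
  rw [Finset.sum_mul_sum, Finset.mul_sum]
  refine Finset.sum_congr rfl fun u _ => ?_
  rw [Finset.mul_sum]
  refine Finset.sum_congr rfl fun v _ => ?_
  rw [← hs]
  ring

end TensorLemmas

theorem traceSnd_pureState {κ ε : Type*} [Fintype ε] (ψ : κ × ε → ℂ) :
    traceSnd (pureState ψ) = ∑ e, pureState fun f => ψ (f, e) := by
  ext f g
  simp [traceSnd, pureState, Matrix.sum_apply, vecMulVec_apply]

theorem posSemidef_pureState {κ : Type*} [Finite κ] (ψ : κ → ℂ) : (pureState ψ).PosSemidef :=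
  posSemidef_vecMulVec_self_star ψ

/-! ### Key generation measurements, Eve's entropy, and the vanishing of the key rate on separable
states -/

namespace Protocol

variable {n : ℕ} {H I O : Fin (n + 1) → Type*} [∀ i, Fintype (H i)] [∀ i, DecidableEq (H i)]
  [∀ i, Fintype (O i)]

/-- The local operators that are trivial except for the key generation outcome `a` of party `i`. -/
noncomputable def keyOp (P : Protocol H I O) (i : Fin (n + 1)) (a : O i) :
    ∀ j, Matrix (H j) (H j) ℂ :=
  Function.update (fun i => (1 : Matrix (H i) (H i) ℂ)) i (P.povm i (P.key i) a)

theorem posSemidef_effect (P : Protocol H I O) (x : ∀ i, I i) (a : ∀ i, O i) :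
    (P.effect x a).PosSemidef :=
  posSemidef_tensor fun i => P.povm_posSemidef i _ _

theorem posSemidef_keyOp (P : Protocol H I O) (i : Fin (n + 1)) (a : O i) (j : Fin (n + 1)) :
    (P.keyOp i a j).PosSemidef := by
  unfold keyOp
  rcases eq_or_ne j i with rfl | h
  · rw [Function.update_self]
    exact P.povm_posSemidef _ _ _
  · rw [Function.update_of_ne h]
    exact PosSemidef.one

theorem posSemidef_update_keyOp (P : Protocol H I O) (i j : Fin (n + 1)) (a : O i) (b : O j)
    (l : Fin (n + 1)) :
    (Function.update (P.keyOp i a) j (P.povm j (P.key j) b) l).PosSemidef := by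
  rcases eq_or_ne l j with rfl | h
  · rw [Function.update_self]
    exact P.povm_posSemidef _ _ _
  · rw [Function.update_of_ne h]
    exact P.posSemidef_keyOp i a l

theorem sum_tensor_keyOp (P : Protocol H I O) (i : Fin (n + 1)) :
    ∑ a, tensor (P.keyOp i a) = 1 := by
  unfold keyOp
  rw [tensor_update_sum, P.povm_sum, Function.update_eq_self_iff.2 rfl, tensor_one]

theorem sum_tensor_update_keyOp (P : Protocol H I O) (i j : Fin (n + 1)) (hij : i ≠ j) (a : O i) :
    ∑ b, tensor (Function.update (P.keyOp i a) j (P.povm j (P.key j) b)) =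
      tensor (P.keyOp i a) := by
  rw [tensor_update_sum, P.povm_sum, Function.update_eq_self_iff.2]
  unfold keyOp
  rw [Function.update_of_ne hij.symm]

theorem sum_tensor_update_keyOp' (P : Protocol H I O) (i j : Fin (n + 1)) (hij : i ≠ j) (b : O j) :
    ∑ a, tensor (Function.update (P.keyOp i a) j (P.povm j (P.key j) b)) =
      tensor (P.keyOp j b) := by
  rw [← sum_tensor_update_keyOp P j i hij.symm b]
  refine Finset.sum_congr rfl fun a _ => ?_
  unfold keyOp
  rw [Function.update_comm hij]

section Eve

variable {ε : Type*} [Fintype ε] [DecidableEq ε]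

/-- Reading `ψ` as a matrix from Eve's space to the parties' makes positivity of Eve's state
visible. -/
theorem eveState_pureState (P : Protocol H I O) (ψ : (∀ i, H i) × ε → ℂ) (a : O 0) :
    P.eveState (pureState ψ) a =
      ((Matrix.of fun f e => ψ (f, e) : Matrix (∀ i, H i) ε ℂ)ᴴ * tensor (P.keyOp 0 a) *
        (Matrix.of fun f e => ψ (f, e) : Matrix (∀ i, H i) ε ℂ))ᵀ := by
  ext e e'
  simp only [eveState, traceFst, of_apply, Matrix.mul_apply, Fintype.sum_prod_type,
    kroneckerMap_apply, transpose_apply, conjTranspose_apply, pureState, vecMulVec_apply,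
    Pi.star_apply, one_apply, mul_ite, mul_one, mul_zero, ite_mul, zero_mul, Finset.sum_ite_eq,
    Finset.mem_univ, if_true, Finset.sum_mul]
  rw [Finset.sum_comm]
  refine Finset.sum_congr rfl fun g _ => Finset.sum_congr rfl fun f _ => ?_
  rw [keyOp]
  ring

theorem posSemidef_eveState (P : Protocol H I O) (ψ : (∀ i, H i) × ε → ℂ) (a : O 0) :
    (P.eveState (pureState ψ) a).PosSemidef := by
  rw [eveState_pureState]
  exact ((posSemidef_tensor (P.posSemidef_keyOp 0 a)).conjTranspose_mul_mul_same _).transpose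

/-- The joint law of X and Eve's standard-basis outcome: label `e` leaves the parties in the
unnormalised vector `ψ (·, e)`. -/
theorem eveState_pureState_diag (P : Protocol H I O) (ψ : (∀ i, H i) × ε → ℂ) (a : O 0) (e : ε) :
    P.eveState (pureState ψ) a e e =
      (tensor (P.keyOp 0 a) * pureState fun f => ψ (f, e)).trace := by
  rw [eveState_pureState]
  simp only [Matrix.trace, diag_apply, of_apply, Matrix.mul_apply, transpose_apply,
    conjTranspose_apply, pureState, vecMulVec_apply, Pi.star_apply, Finset.sum_mul]
  rw [Finset.sum_comm]
  refine Finset.sum_congr rfl fun g _ => Finset.sum_congr rfl fun f _ => ?_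
  ring

theorem sum_eveState (P : Protocol H I O) (R : Matrix ((∀ i, H i) × ε) ((∀ i, H i) × ε) ℂ) :
    ∑ a, P.eveState R a = traceFst R := by
  have h := P.sum_tensor_keyOp 0
  unfold keyOp at h
  have h1 : ∑ a, ((tensor (Function.update (fun i => (1 : Matrix (H i) (H i) ℂ)) 0
      (P.povm 0 (P.key 0) a)) ⊗ₖ (1 : Matrix ε ε ℂ)) * R) = R := by
    rw [← Finset.sum_mul]
    have h2 : ∑ a, (tensor (Function.update (fun i => (1 : Matrix (H i) (H i) ℂ)) 0
        (P.povm 0 (P.key 0) a)) ⊗ₖ (1 : Matrix ε ε ℂ)) = 1 := by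
      rw [← one_kronecker_one, ← h]
      ext fe fe'
      simp [kroneckerMap_apply, Matrix.sum_apply, Finset.sum_mul]
    rw [h2, Matrix.one_mul]
  ext e e'
  conv_rhs => rw [← h1]
  simp only [eveState, traceFst, of_apply, Matrix.sum_apply]
  exact Finset.sum_comm

variable [∀ i, DecidableEq (O i)]

theorem condEntropyEve_nonneg (P : Protocol H I O) (ψ : (∀ i, H i) × ε → ℂ) :
    0 ≤ P.condEntropyEve (pureState ψ) := by
  unfold condEntropyEve
  rw [← P.sum_eveState]
  exact entropy_blockDiagonal_sub_nonneg (P.posSemidef_eveState ψ)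

/-- Eve may measure her system in the standard basis. -/
theorem condEntropyEve_le (P : Protocol H I O) (ψ : (∀ i, H i) × ε → ℂ) :
    P.condEntropyEve (pureState ψ) ≤
      -∑ a, ∑ e, (tensor (P.keyOp 0 a) * pureState fun f => ψ (f, e)).trace.re *
        Real.logb 2 ((tensor (P.keyOp 0 a) * pureState fun f => ψ (f, e)).trace.re /
          ∑ b, (tensor (P.keyOp 0 b) * pureState fun f => ψ (f, e)).trace.re) := by
  unfold condEntropyEve
  rw [← P.sum_eveState]
  simpa only [eveState_pureState_diag] using
    entropy_blockDiagonal_sub_le (P.posSemidef_eveState ψ)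

end Eve

variable [∀ i, DecidableEq (O i)]

/-- Without a lower bound, `sInf` would take its default value 0 and need not lie below the members
of the set. -/
theorem bddBelow_eveEntropies (P : Protocol H I O) (ρ : Matrix (∀ i, H i) (∀ i, H i) ℂ) :
    BddBelow (P.eveEntropies ρ) := by
  refine ⟨0, ?_⟩
  rintro _ ⟨k, ψ, -, -, rfl⟩
  exact P.condEntropyEve_nonneg ψ

/-- Summing over the outcomes of the other parties turns their POVM elements into identities. -/
theorem keyDist_eq (P : Protocol H I O) (ρ : Matrix (∀ i, H i) (∀ i, H i) ℂ) (i : Fin n)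
    (a : O 0) (b : O i.succ) :
    P.keyDist ρ i (a, b) = (tensor (Function.update (P.keyOp 0 a) i.succ
      (P.povm i.succ (P.key i.succ) b)) * ρ).trace.re := by
  set s : ∀ j, Finset (O j) :=
    Function.update (Function.update (fun j => Finset.univ) 0 {a}) i.succ {b} with hs
  have hne : (0 : Fin (n + 1)) ≠ i.succ := (Fin.succ_ne_zero i).symm
  have h1 : Finset.univ.filter (fun o : ∀ j, O j => o 0 = a ∧ o i.succ = b) =
      Fintype.piFinset s := by
    ext o
    simp only [Finset.mem_filter, Finset.mem_univ, true_and, Fintype.mem_piFinset]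
    constructor
    · rintro ⟨h0, h1⟩ j
      rcases eq_or_ne j i.succ with rfl | hj
      · simp [hs, h1]
      rcases eq_or_ne j 0 with rfl | hj'
      · simp [hs, Function.update_of_ne hj, h0]
      · simp [hs, Function.update_of_ne hj, Function.update_of_ne hj']
    · intro h
      have ha := h 0
      have hb := h i.succ
      rw [hs, Function.update_of_ne hne, Function.update_self, Finset.mem_singleton] at ha
      rw [hs, Function.update_self, Finset.mem_singleton] at hb
      exact ⟨ha, hb⟩
  have h2 : (fun j => ∑ c ∈ s j, P.povm j (P.key j) c) =
      Function.update (P.keyOp 0 a) i.succ (P.povm i.succ (P.key i.succ) b) := by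
    ext1 j
    unfold keyOp
    rcases eq_or_ne j i.succ with rfl | hj
    · simp [hs]
    rcases eq_or_ne j 0 with rfl | hj'
    · simp [hs, Function.update_of_ne hj]
    · simp [hs, Function.update_of_ne hj, Function.update_of_ne hj', P.povm_sum]
  unfold keyDist
  rw [← Finset.sum_filter, h1, ← h2, ← sum_tensor_piFinset, Finset.sum_mul, Matrix.trace_sum,
    Complex.re_sum]
  rfl

theorem condEntropyBob_congr (P : Protocol H I O) {ρ σ : Matrix (∀ i, H i) (∀ i, H i) ℂ}
    (h : P.SameStatistics ρ σ) (i : Fin n) : P.condEntropyBob ρ i = P.condEntropyBob σ i := by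
  have h1 : P.keyDist ρ i = P.keyDist σ i := by
    ext ab
    simp only [keyDist, h P.key]
  simp only [condEntropyBob, h1]

/-- For a mixture of pure product states that separate Alice from the `i`-th Bob, the purification
whose Eve's system labels the states of the mixture satisfies `H(X|E) ≤ H(X|Yᵢ)`. -/
theorem condEntropyEve_le_condEntropyBob (P : Protocol H I O) {S : Finset (Fin (n + 1))}
    {i : Fin n} (hi : 0 ∈ S ↔ i.succ ∉ S) {k : ℕ}
    (φ : Fin k → (∀ i : {i // i ∈ S}, H i) → ℂ) (χ : Fin k → (∀ i : {i // i ∉ S}, H i) → ℂ) :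
    P.condEntropyEve (pureState fun fe : (∀ i, H i) × Fin k =>
        φ fe.2 (fun i => fe.1 i) * χ fe.2 (fun i => fe.1 i)) ≤
      P.condEntropyBob (∑ e, bipartiteTensor S (pureState (φ e)) (pureState (χ e))) i := by
  have hne : (0 : Fin (n + 1)) ≠ i.succ := (Fin.succ_ne_zero i).symm
  refine (P.condEntropyEve_le _).trans ?_
  simp only [← bipartiteTensor_pureState S (φ _) (χ _)]
  set R : Fin k → Matrix (∀ i, H i) (∀ i, H i) ℂ := fun e =>
    bipartiteTensor S (pureState (φ e)) (pureState (χ e)) with hR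
  have hRpos : ∀ e, (R e).PosSemidef := fun e =>
    posSemidef_bipartiteTensor S (posSemidef_pureState _) (posSemidef_pureState _)
  set T : O 0 → O i.succ → Matrix (∀ i, H i) (∀ i, H i) ℂ := fun a b =>
    tensor (Function.update (P.keyOp 0 a) i.succ (P.povm i.succ (P.key i.succ) b)) with hT
  have hT1 : ∀ a e, (tensor (P.keyOp 0 a) * R e).trace.re = ∑ b, (T a b * R e).trace.re := by
    intro a e
    rw [← P.sum_tensor_update_keyOp 0 i.succ hne a, Finset.sum_mul, Matrix.trace_sum,
      Complex.re_sum]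
  have hT2 : ∀ b e, (tensor (P.keyOp i.succ b) * R e).trace.re = ∑ a, (T a b * R e).trace.re := by
    intro b e
    rw [← P.sum_tensor_update_keyOp' 0 i.succ hne b, Finset.sum_mul, Matrix.trace_sum,
      Complex.re_sum]
  have hT3 : ∀ e, (R e).trace.re = ∑ a, ∑ b, (T a b * R e).trace.re := by
    intro e
    simp only [← hT1, ← Complex.re_sum, ← Matrix.trace_sum, ← Finset.sum_mul]
    rw [P.sum_tensor_keyOp, Matrix.one_mul]
  have hreal : ∀ z : ℂ, 0 ≤ z → z = (z.re : ℂ) := fun z hz =>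
    Complex.eq_re_of_ofReal_le (r := 0) (by simpa using hz)
  have hTpos : ∀ a b, (T a b).PosSemidef := fun a b =>
    posSemidef_tensor (P.posSemidef_update_keyOp 0 i.succ a b)
  have hKpos : ∀ j c, (tensor (P.keyOp j c)).PosSemidef := fun j c =>
    posSemidef_tensor (P.posSemidef_keyOp j c)
  -- `p` is the joint law of X, Yᵢ and Eve's label; each `R e` is a product across the cut, which
  -- gives independence.
  have hmain := condEntropy_le_of_markov (p := fun a b e => (T a b * R e).trace.re)
    (fun a b e => (Complex.nonneg_iff.1 (trace_mul_nonneg (hTpos a b) (hRpos e))).1)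
    (fun a b e => by
      have h := trace_tensor_update_mul_bipartiteTensor S hi (pureState (φ e)) (pureState (χ e))
        (P.povm 0 (P.key 0) a) (P.povm i.succ (P.key i.succ) b)
      change (T a b * R e).trace * (R e).trace =
        (tensor (P.keyOp 0 a) * R e).trace * (tensor (P.keyOp i.succ b) * R e).trace at h
      rw [hreal _ (trace_mul_nonneg (hTpos a b) (hRpos e)), hreal _ (hRpos e).trace_nonneg,
        hreal _ (trace_mul_nonneg (hKpos 0 a) (hRpos e)),
        hreal _ (trace_mul_nonneg (hKpos i.succ b) (hRpos e))] at h
      rw [← hT1, ← hT2, ← hT3]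
      exact_mod_cast h)
  have hdist : ∀ a b, P.keyDist (∑ e, R e) i (a, b) = ∑ e, (T a b * R e).trace.re := by
    intro a b
    rw [keyDist_eq, Finset.mul_sum, Matrix.trace_sum, Complex.re_sum]
  have hbob : P.condEntropyBob (∑ e, R e) i =
      shannonEntropy (fun ab : O 0 × O i.succ => ∑ e, (T ab.1 ab.2 * R e).trace.re) -
        shannonEntropy (fun b => ∑ a, ∑ e, (T a b * R e).trace.re) := by
    simp only [condEntropyBob, ← hdist]
  rw [hbob]
  simp only [← hT1] at hmain
  exact hmain

/-- A positive key rate excludes states that are separable across some partition. -/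
theorem not_isSeparable_of_keyRate_pos (P : Protocol H I O)
    {ρ σ : Matrix (∀ i, H i) (∀ i, H i) ℂ} (hr : 0 < P.keyRate ρ)
    {S : Finset (Fin (n + 1))} (hS : S.Nonempty) (hS' : S ≠ Finset.univ)
    (hσ : P.SameStatistics ρ σ) : ¬ IsSeparable S σ := by
  intro hsep
  -- A Bob on the other side of the cut from Alice exists because both sides are nonempty.
  obtain ⟨i, hi⟩ : ∃ i : Fin n, 0 ∈ S ↔ i.succ ∉ S := by
    by_cases h0 : 0 ∈ S
    · obtain ⟨j, hj⟩ : ∃ j, j ∉ S := by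
        by_contra! h
        exact hS' (Finset.eq_univ_iff_forall.2 h)
      obtain ⟨i, rfl⟩ := Fin.exists_succ_eq.2 (show j ≠ 0 from fun h => hj (h ▸ h0))
      exact ⟨i, by tauto⟩
    · obtain ⟨j, hj⟩ := hS
      obtain ⟨i, rfl⟩ := Fin.exists_succ_eq.2 (show j ≠ 0 from fun h => h0 (h ▸ hj))
      exact ⟨i, by tauto⟩
  have hstate := hsep.isState
  obtain ⟨k, φ, χ, rfl⟩ := hsep.exists_pure
  have hle := P.condEntropyEve_le_condEntropyBob hi φ χ
  set ψ : (∀ i, H i) × Fin k → ℂ := fun fe =>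
    φ fe.2 (fun i => fe.1 i) * χ fe.2 (fun i => fe.1 i) with hψ
  have htr : traceSnd (pureState ψ) =
      ∑ e, bipartiteTensor S (pureState (φ e)) (pureState (χ e)) := by
    rw [traceSnd_pureState]
    exact Finset.sum_congr rfl fun e _ => (bipartiteTensor_pureState S (φ e) (χ e)).symm
  have hmem : P.condEntropyEve (pureState ψ) ∈ P.eveEntropies ρ :=
    ⟨k, ψ, htr ▸ hstate, htr ▸ hσ, rfl⟩
  have h1 := csInf_le (P.bddBelow_eveEntropies ρ) hmem
  have h2 := le_ciSup (Set.finite_range (P.condEntropyBob ρ)).bddAbove i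
  rw [← P.condEntropyBob_congr hσ i] at hle
  unfold keyRate at hr
  rw [lt_max_iff] at hr
  rcases hr with hr | hr <;> linarith

end Protocol

/-! ### Compactness of convex hulls and of the set of states -/

section Compactness

/-- Carathéodory's theorem, with a fixed number of points. -/
theorem convexHull_eq_image_stdSimplex {E : Type*} [AddCommGroup E] [Module ℝ E]
    [FiniteDimensional ℝ E] (s : Set E) :
    convexHull ℝ s =
      (fun wv : (Fin (Module.finrank ℝ E + 1) → ℝ) × (Fin (Module.finrank ℝ E + 1) → E) =>
        ∑ i, wv.1 i • wv.2 i) ''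
      (stdSimplex ℝ (Fin (Module.finrank ℝ E + 1)) ×ˢ Set.univ.pi fun _ => s) := by
  refine Set.Subset.antisymm ?_ ?_
  · intro x hx
    obtain ⟨ι, _, z, w, hz, hind, hw, hw1, rfl⟩ := eq_pos_convex_span_of_mem_convexHull hx
    have hcard : Fintype.card ι ≤ Fintype.card (Fin (Module.finrank ℝ E + 1)) := by
      rw [Fintype.card_fin]
      refine hind.card_le_finrank_succ.trans ?_
      gcongr
      exact Submodule.finrank_le _
    obtain ⟨g⟩ := Function.Embedding.nonempty_of_card_le hcard
    have hne : Nonempty ι := by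
      by_contra h
      rw [not_nonempty_iff] at h
      simp at hw1
    obtain ⟨i₀⟩ := hne
    -- Unused slots get weight 0 and an arbitrary point of `s`.
    refine ⟨(Function.extend g w 0, Function.extend g z fun _ => z i₀), ⟨⟨?_, ?_⟩, ?_⟩, ?_⟩
    · intro j
      dsimp only
      by_cases hj : ∃ i, g i = j
      · obtain ⟨i, rfl⟩ := hj
        rw [g.injective.extend_apply]
        exact (hw i).le
      · rw [Function.extend_apply' _ _ _ hj]
        rfl
    · rw [← hw1]
      refine (Fintype.sum_of_injective g g.injective _ _ (fun j hj => ?_) fun i => ?_).symm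
      · exact Function.extend_apply' _ _ _ (by simpa using hj)
      · exact (g.injective.extend_apply _ _ _).symm
    · intro j _
      by_cases hj : ∃ i, g i = j
      · obtain ⟨i, rfl⟩ := hj
        simp only [g.injective.extend_apply]
        exact hz ⟨i, rfl⟩
      · simp only [Function.extend_apply' _ _ _ hj]
        exact hz ⟨i₀, rfl⟩
    · refine (Fintype.sum_of_injective g g.injective _ _ (fun j hj => ?_) fun i => ?_).symm
      · simp only
        rw [Function.extend_apply' w _ _ (by simpa using hj), Pi.zero_apply, zero_smul]
      · simp only [g.injective.extend_apply]
  · rintro _ ⟨⟨w, v⟩, ⟨⟨hw, hw1⟩, hv⟩, rfl⟩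
    exact (convex_convexHull ℝ s).sum_mem (fun i _ => hw i) hw1
      fun i _ => subset_convexHull ℝ s (hv i (Set.mem_univ i))

theorem isCompact_convexHull_of_finiteDimensional {E : Type*} [AddCommGroup E] [Module ℝ E]
    [FiniteDimensional ℝ E] [TopologicalSpace E] [ContinuousAdd E] [ContinuousSMul ℝ E]
    {s : Set E} (hs : IsCompact s) : IsCompact (convexHull ℝ s) := by
  rw [convexHull_eq_image_stdSimplex]
  refine ((isCompact_stdSimplex ℝ _).prod (isCompact_univ_pi fun _ => hs)).image ?_
  fun_prop

/-- States are the image of the Frobenius unit sphere under M ↦ MᴴM. -/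
theorem isCompact_setOf_isState {κ : Type*} [Fintype κ] :
    IsCompact {A : Matrix κ κ ℂ | IsState A} := by
  have h1 : {A : Matrix κ κ ℂ | IsState A} =
      (fun M : Matrix κ κ ℂ => Mᴴ * M) '' {M | (Mᴴ * M).trace = 1} := by
    ext A
    constructor
    · rintro ⟨hA, hA1⟩
      obtain ⟨M, rfl⟩ := exists_eq_conjTranspose_mul hA
      exact ⟨M, hA1, rfl⟩
    · rintro ⟨M, hM, rfl⟩
      exact ⟨posSemidef_conjTranspose_mul_self M, hM⟩
  have hcont : Continuous fun M : Matrix κ κ ℂ => Mᴴ * M :=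
    continuous_id.matrix_conjTranspose.matrix_mul continuous_id
  rw [h1]
  refine IsCompact.image ?_ hcont
  have hK : IsCompact (Set.univ.pi fun _ : κ => Set.univ.pi fun _ : κ =>
      Metric.closedBall (0 : ℂ) 1) :=
    isCompact_univ_pi fun _ => isCompact_univ_pi fun _ => isCompact_closedBall 0 1
  refine IsCompact.of_isClosed_subset hK (isClosed_eq hcont.matrix_trace continuous_const) ?_
  intro M hM i _ j _
  rw [mem_closedBall_zero_iff]
  have h2 : ∑ j, ∑ i, ‖M i j‖ ^ 2 = 1 := by
    have h3 : ((∑ j, ∑ i, ‖M i j‖ ^ 2 : ℝ) : ℂ) = 1 := by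
      rw [← show (Mᴴ * M).trace = 1 from hM]
      simp only [Matrix.trace, diag_apply, Matrix.mul_apply, conjTranspose_apply,
        Complex.ofReal_sum]
      refine Finset.sum_congr rfl fun j _ => Finset.sum_congr rfl fun i _ => ?_
      rw [← Complex.normSq_eq_norm_sq, Complex.normSq_eq_conj_mul_self]
      rfl
    exact_mod_cast h3
  have h4 : ‖M i j‖ ^ 2 ≤ 1 := by
    rw [← h2]
    refine le_trans ?_ (Finset.single_le_sum (f := fun j => ∑ i, ‖M i j‖ ^ 2)
      (fun j _ => Finset.sum_nonneg fun i _ => by positivity) (Finset.mem_univ j))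
    exact Finset.single_le_sum (f := fun i => ‖M i j‖ ^ 2) (fun i _ => by positivity)
      (Finset.mem_univ i)
  exact (sq_le_one_iff₀ (norm_nonneg _)).1 h4

theorem continuous_bipartiteTensor {ι : Type*} {H : ι → Type*} (S : Finset ι) :
    Continuous fun AB : Matrix (∀ i : {i // i ∈ S}, H i) (∀ i : {i // i ∈ S}, H i) ℂ ×
      Matrix (∀ i : {i // i ∉ S}, H i) (∀ i : {i // i ∉ S}, H i) ℂ =>
      bipartiteTensor S AB.1 AB.2 := by
  refine continuous_matrix fun f g => ?_
  exact (continuous_fst.matrix_elem _ _).mul (continuous_snd.matrix_elem _ _)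

end Compactness

/-! ### Construction of the witness by separation of statistics -/

namespace Protocol

variable {n : ℕ} {H I O : Fin (n + 1) → Type*} [∀ i, Fintype (H i)] [∀ i, DecidableEq (H i)]
  [∀ i, Fintype (O i)]

theorem sum_effect (P : Protocol H I O) (x : ∀ i, I i) : ∑ a, P.effect x a = 1 := by
  have h := sum_tensor_piFinset (fun i => P.povm i (x i)) fun _ => Finset.univ
  rw [Fintype.piFinset_univ] at h
  simp only [P.povm_sum, tensor_one] at h
  exact h

theorem sum_prob (P : Protocol H I O) {σ : Matrix (∀ i, H i) (∀ i, H i) ℂ} (hσ : σ.trace = 1)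
    (x : ∀ i, I i) : ∑ a, P.prob σ x a = 1 := by
  simp only [prob, ← Complex.re_sum, ← Matrix.trace_sum, ← Finset.sum_mul]
  rw [sum_effect, Matrix.one_mul, hσ, Complex.one_re]

theorem prob_sum_smul (P : Protocol H I O) {α : Type*} [Fintype α] (q : α → ℝ)
    (σ : α → Matrix (∀ i, H i) (∀ i, H i) ℂ) (x : ∀ i, I i) (a : ∀ i, O i) :
    P.prob (∑ j, (q j : ℂ) • σ j) x a = ∑ j, q j * P.prob (σ j) x a := by
  simp only [prob, Finset.mul_sum, Matrix.trace_sum, Complex.re_sum, Matrix.mul_smul,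
    Matrix.trace_smul, smul_eq_mul, Complex.re_ofReal_mul]

variable [∀ i, Fintype (I i)]

theorem trace_witness_mul (P : Protocol H I O) (c : (∀ i, I i) → (∀ i, O i) → ℝ)
    (σ : Matrix (∀ i, H i) (∀ i, H i) ℂ) :
    (P.witness c * σ).trace.re = ∑ x, ∑ a, c x a * P.prob σ x a := by
  simp only [witness, prob, Finset.sum_mul, Matrix.trace_sum, Complex.re_sum, Matrix.smul_mul,
    Matrix.trace_smul, smul_eq_mul, Complex.re_ofReal_mul]

theorem isHermitian_witness (P : Protocol H I O) (c : (∀ i, I i) → (∀ i, O i) → ℝ) :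
    (P.witness c).IsHermitian := by
  unfold witness IsHermitian
  simp only [conjTranspose_sum, conjTranspose_smul, (P.posSemidef_effect _ _).1.eq,
    Complex.star_def, Complex.conj_ofReal]

/-- A state whose statistics no separable state has is detected by a witness built from the
measured observables. -/
theorem exists_witness (P : Protocol H I O) (S : Finset (Fin (n + 1)))
    {ρ : Matrix (∀ i, H i) (∀ i, H i) ℂ} (hρ : IsState ρ)
    (hsep : ∀ σ : Matrix (∀ i, H i) (∀ i, H i) ℂ, P.SameStatistics ρ σ → ¬ IsSeparable S σ) :
    ∃ c : (∀ i, I i) → (∀ i, O i) → ℝ,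
      IsEntanglementWitness S (P.witness c) ∧ (P.witness c * ρ).trace.re < 0 := by
  classical
  let stat : Matrix (∀ i, H i) (∀ i, H i) ℂ → ((∀ i, I i) × (∀ i, O i) → ℝ) :=
    fun σ xa => P.prob σ xa.1 xa.2
  have hstat : Continuous stat := by
    refine continuous_pi fun xa => ?_
    exact Complex.continuous_re.comp
      (continuous_const.matrix_mul continuous_id).matrix_trace
  let K : Set ((∀ i, I i) × (∀ i, O i) → ℝ) :=
    (fun AB : Matrix (∀ i : {i // i ∈ S}, H i) (∀ i : {i // i ∈ S}, H i) ℂ ×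
      Matrix (∀ i : {i // i ∉ S}, H i) (∀ i : {i // i ∉ S}, H i) ℂ =>
      stat (bipartiteTensor S AB.1 AB.2)) '' ({A | IsState A} ×ˢ {B | IsState B})
  have hK : IsCompact K := (isCompact_setOf_isState.prod isCompact_setOf_isState).image
    (hstat.comp (continuous_bipartiteTensor S))
  -- A convex combination of product statistics is the statistics of the corresponding mixture,
  -- which is separable.
  have hnot : stat ρ ∉ convexHull ℝ K := by
    rw [convexHull_eq_image_stdSimplex]
    rintro ⟨⟨w, v⟩, ⟨⟨hw, hw1⟩, hv⟩, hwv⟩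
    choose AB hAB hABv using fun i => hv i (Set.mem_univ i)
    refine hsep (∑ j, (w j : ℂ) • bipartiteTensor S (AB j).1 (AB j).2) (fun x a => ?_)
      ⟨_, w, fun j => (AB j).1, fun j => (AB j).2, hw, hw1, fun j => (hAB j).1,
        fun j => (hAB j).2, rfl⟩
    rw [prob_sum_smul]
    have h1 := congrFun hwv (x, a)
    simp only [Finset.sum_apply, Pi.smul_apply, smul_eq_mul] at h1
    change _ = P.prob ρ x a at h1
    rw [← h1]
    refine Finset.sum_congr rfl fun j _ => ?_
    have h2 : v j (x, a) = P.prob (bipartiteTensor S (AB j).1 (AB j).2) x a :=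
      (congrFun (hABv j) (x, a)).symm
    rw [h2]
  obtain ⟨f, u, hfρ, hfK⟩ := geometric_hahn_banach_point_closed (convex_convexHull ℝ K)
    (isCompact_convexHull_of_finiteDimensional hK).isClosed hnot
  -- The threshold `u` is subtracted at one joint setting only: the probabilities there sum to 1, so
  -- the witness has expectation `f (stat σ) - u`.
  let c : (∀ i, I i) → (∀ i, O i) → ℝ := fun x a =>
    f (Pi.single (x, a) 1) - if x = P.key then u else 0
  have hc : ∀ σ : Matrix (∀ i, H i) (∀ i, H i) ℂ, σ.trace = 1 →
      (P.witness c * σ).trace.re = f (stat σ) - u := by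
    intro σ hσ
    rw [trace_witness_mul]
    have h1 : f (stat σ) = ∑ x, ∑ a, f (Pi.single (x, a) 1) * P.prob σ x a := by
      conv_lhs => rw [pi_eq_sum_univ' (stat σ)]
      rw [map_sum, Fintype.sum_prod_type]
      refine Finset.sum_congr rfl fun x _ => Finset.sum_congr rfl fun a _ => ?_
      rw [map_smul, smul_eq_mul, mul_comm]
    have h2 : ∑ x, ∑ a, (if x = P.key then u else 0) * P.prob σ x a = u := by
      simp only [← Finset.mul_sum, P.sum_prob hσ, mul_one]
      simp
    rw [h1]
    conv_rhs => rw [← h2]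
    simp only [c, sub_mul, Finset.sum_sub_distrib]
  have hneg : (P.witness c * ρ).trace.re < 0 := by
    rw [hc ρ hρ.2]
    linarith
  -- `ρ` itself is the entangled state with negative expectation: it shares its own statistics,
  -- hence is not separable.
  refine ⟨c, ⟨P.isHermitian_witness c, ?_, ρ, hρ, hsep ρ fun _ _ => rfl, hneg⟩, hneg⟩
  rintro _ ⟨m, q, A, B, hq, hq1, hA, hB, rfl⟩
  rw [Finset.mul_sum, Matrix.trace_sum, Complex.re_sum]
  refine Finset.sum_nonneg fun j _ => ?_
  rw [Matrix.mul_smul, Matrix.trace_smul, smul_eq_mul, Complex.re_ofReal_mul,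
    hc _ (isState_bipartiteTensor S (hA j) (hB j)).2]
  refine mul_nonneg (hq j) (sub_nonneg.2 (hfK _ (subset_convexHull ℝ K ?_)).le)
  exact ⟨(A j, B j), ⟨hA j, hB j⟩, rfl⟩

end Protocol

end CKA

theorem theorem2 {n : ℕ} {H I O : Fin (n + 1) → Type*}
    [∀ i, Fintype (H i)] [∀ i, DecidableEq (H i)]
    [∀ i, Fintype (I i)] [∀ i, Fintype (O i)] [∀ i, DecidableEq (O i)]
    (P : CKA.Protocol H I O)
    (ρ : Matrix (∀ i, H i) (∀ i, H i) ℂ) (hρ : CKA.IsState ρ)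
    (hr : 0 < P.keyRate ρ)
    (S : Finset (Fin (n + 1))) (hS : S.Nonempty) (hS' : S ≠ Finset.univ) :
    (∀ σ : Matrix (∀ i, H i) (∀ i, H i) ℂ, P.SameStatistics ρ σ → ¬ CKA.IsSeparable S σ) ∧
    ∃ c : (∀ i, I i) → (∀ i, O i) → ℝ,
      CKA.IsEntanglementWitness S (P.witness c) ∧ (P.witness c * ρ).trace.re < 0 := by
  have h := fun σ => P.not_isSeparable_of_keyRate_pos (σ := σ) hr hS hS'
  exact ⟨h, P.exists_witness S hρ h⟩
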